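/- Let $(X_n)_{n\ge 1}$ be real random variables on a probability space $(\Omega,\mathcal F,\mathbf P)$ with $\mathbb E\{X_n\}=0$ and $\mathbb E\{|X_n|^p\}<\infty$ for all $n\ge1$, $p\in\mathbb N$. Let $\sigma(n)^2$ be the variance of $X_1+\dots+X_n$ and assume $\sigma(n)>0$ for all $n\ge 1$. Let $\tau(n)\in\mathbb N$ ($n\geq 1$) be a nondecreasing sequence with $\tau(1)=0$, $\tau(n)\le n$ and $\tau(n)/n\to0$. Put $u(1)=1$, $t(1)=0$ and, for $n\ge2$, $u=u(n)=\max\{m\ge1 : 2m+\tau(m)\le n\}$ and $t=t(n)=n-2u(n)$. Put $$S_u=\frac{X_1+\dots+X_u}{\sigma(u)},\qquad \xi_u=\frac{X_{u+1}+\dots+X_{u+t}}{\sigma(u)},\qquad S'_u=\frac{X_{u+t+1}+\dots+X_{u+t+u}}{\sigma(u)}$$ (with $\xi_u=0$ if $t=0$). Assume that $\mathbb E\{(\xi_u)^p\}\to0$ as $n\to\infty$ for every $p\ge1$, and that there are two sequences of random variables $\varepsilon=\varepsilon_n$, $\varepsilon'=\varepsilon'_n$ with finite moments of all orders and $\mathbb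 E\{\varepsilon^p\}+\mathbb E\{\varepsilon'^p\}\to0$ for every $p\ge1$, such that, as $n\to\infty$, - ($H_{mS}$) $\mathbb E\{(S_u+\varepsilon)^p\}-\mathbb E\{(S'_u+\varepsilon')^p\}\to0$ for all $p\in\mathbb N$; - ($H_{mI}$) $\mathbb E\{(S_u+\varepsilon)^p(S'_u+\varepsilon')^q\}-\mathbb E\{(S_u+\varepsilon)^p\}\,\mathbb E\{(S'_u+\varepsilon')^q\}\to0$ for all $p,q\ge1$. For sequences of square-integrable random variables $U=U_n$, $V=V_n$ put $\sigma_U(u)=\mathbb E\{(S_u+U)^2\}^{1/2}$, $A_{k,j}=\{\sigma_U(u)^{-1}(S_u+U)\in[4^{-k}j,4^{-k}(j+1))\}$ and $B_{k,j}=\{\sigma_U(u)^{-1}(S'_u+V)\in[4^{-k}j,4^{-k}(j+1))\}$, and consider the relations, as $n\to\infty$, - ($H_S$) $\mathbf P\{A_{k,j}\}-\mathbf P\{B_{k,j}\}\to0$ for all $k\in\mathbb N$, $j\in\mathbb Z$; - ($H_I$) $\mathbf P\{A_{k,j}\cap B_{k,j'}\}-\mathbf P\{A_{k,j}\}\mathbf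 P\{B_{k,j'}\}\to0$ for all $k\in\mathbb N$, $j,j'\in\mathbb Z$. Conditions $H_S$ and $H_I$ are said to hold if there are $U,V$ with $\mathbb E\{U_n\}=\mathbb E\{V_n\}=0$ for all $n$ and $\mathbb E\{U_n^2\}+\mathbb E\{V_n^2\}\to0$ for which both relations are satisfied. Then conditions $H_S$ and $H_I$ hold. Moreover, both relations are also satisfied by $U=\varepsilon$, $V=\varepsilon'$; for all $p,q\in\mathbb N$, $\mathbb E\{(S_u+\varepsilon)^p(S'_u+\varepsilon')^q\}\to\mu_p\mu_q$, where $\mu_p$ is the $p$-th moment of $N(0,1)$; and $(S_u+\varepsilon,S'_u+\varepsilon')$ converges in distribution to $N(0,1)\times N(0,1)$. -/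

import Mathlib

open MeasureTheory ProbabilityTheory Filter Topology

noncomputable section

namespace BlockCLT

/-- A gap sequence `τ(1) ≤ τ(2) ≤ ...` of natural numbers: nondecreasing, `τ(1) = 0`,
`τ(n) ≤ n` and `τ(n) / n → 0`. Only the values at `n ≥ 1` are relevant. -/
structure IsGapSequence (τ : ℕ → ℕ) : Prop where
  mono : ∀ m n : ℕ, 1 ≤ m → m ≤ n → τ m ≤ τ n
  one : τ 1 = 0
  le_self : ∀ n : ℕ, 1 ≤ n → τ n ≤ n
  tendsto_div : Tendsto (fun n : ℕ => (τ n : ℝ) / (n : ℝ)) atTop (𝓝 0)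

/-- Block length: `u(1) = 1` and, for `n ≥ 2`, `u(n) = max {m ≥ 1 | 2 m + τ(m) ≤ n}`.
For `n ≥ 2` the set is nonempty (if `τ 1 = 0`) and bounded by `n`, so `sSup` is its maximum. -/
def blockLength (τ : ℕ → ℕ) (n : ℕ) : ℕ :=
  if n ≤ 1 then 1 else sSup {m : ℕ | 1 ≤ m ∧ 2 * m + τ m ≤ n}

/-- Gap length: `t(1) = 0` and, for `n ≥ 2`, `t(n) = n - 2 u(n)` (here `2 u(n) ≤ n`). -/
def gapLength (τ : ℕ → ℕ) (n : ℕ) : ℕ := n - 2 * blockLength τ n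

section Sums

variable {Ω : Type*} [MeasurableSpace Ω]

/-- `σ(n)`, the standard deviation of `X₁ + ... + Xₙ`. -/
def stdDev (P : Measure Ω) (X : ℕ → Ω → ℝ) (n : ℕ) : ℝ :=
  √(variance (fun ω => ∑ i ∈ Finset.Icc 1 n, X i ω) P)

/-- First block `S_u = (X₁ + ... + X_u) / σ(u)`, with `u = u(n)`. -/
def firstBlock (P : Measure Ω) (X : ℕ → Ω → ℝ) (τ : ℕ → ℕ) (n : ℕ) (ω : Ω) : ℝ :=
  (∑ i ∈ Finset.Icc 1 (blockLength τ n), X i ω) / stdDev P X (blockLength τ n)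

/-- Middle block `ξ_u = (X_{u+1} + ... + X_{u+t}) / σ(u)`, with `u = u(n)`, `t = t(n)`;
it is `0` when `t = 0`. -/
def middleBlock (P : Measure Ω) (X : ℕ → Ω → ℝ) (τ : ℕ → ℕ) (n : ℕ) (ω : Ω) : ℝ :=
  (∑ i ∈ Finset.Icc (blockLength τ n + 1) (blockLength τ n + gapLength τ n), X i ω) /
    stdDev P X (blockLength τ n)

/-- Last block `S'_u = (X_{u+t+1} + ... + X_{u+t+u}) / σ(u)`, with `u = u(n)`, `t = t(n)`. -/
def lastBlock (P : Measure Ω) (X : ℕ → Ω → ℝ) (τ : ℕ → ℕ) (n : ℕ) (ω : Ω) : ℝ :=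
  (∑ i ∈ Finset.Icc (blockLength τ n + gapLength τ n + 1)
      (blockLength τ n + gapLength τ n + blockLength τ n), X i ω) /
    stdDev P X (blockLength τ n)

/-- `H_mS` (all orders): `E[(S_u + ε)^p] - E[(S'_u + ε')^p] → 0` for every `p`. -/
def MomentCondS (P : Measure Ω) (X : ℕ → Ω → ℝ) (τ : ℕ → ℕ) (ε ε' : ℕ → Ω → ℝ) : Prop :=
  ∀ p : ℕ, Tendsto (fun n : ℕ =>
    (∫ ω, (firstBlock P X τ n ω + ε n ω) ^ p ∂P) -
      ∫ ω, (lastBlock P X τ n ω + ε' n ω) ^ p ∂P) atTop (𝓝 0)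

/-- `H_mI` (all orders): the mixed moments of `S_u + ε` and `S'_u + ε'` asymptotically factorize. -/
def MomentCondI (P : Measure Ω) (X : ℕ → Ω → ℝ) (τ : ℕ → ℕ) (ε ε' : ℕ → Ω → ℝ) : Prop :=
  ∀ p q : ℕ, 1 ≤ p → 1 ≤ q → Tendsto (fun n : ℕ =>
    (∫ ω, (firstBlock P X τ n ω + ε n ω) ^ p * (lastBlock P X τ n ω + ε' n ω) ^ q ∂P) -
      (∫ ω, (firstBlock P X τ n ω + ε n ω) ^ p ∂P) *
        ∫ ω, (lastBlock P X τ n ω + ε' n ω) ^ q ∂P) atTop (𝓝 0)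

/-- `σ_ε(u)`, where `σ_ε(u)² = E[(S_u + ε)²]`. -/
def perturbedScale (P : Measure Ω) (X : ℕ → Ω → ℝ) (τ : ℕ → ℕ) (ε : ℕ → Ω → ℝ) (n : ℕ) : ℝ :=
  √(∫ ω, (firstBlock P X τ n ω + ε n ω) ^ 2 ∂P)

/-- The cell `[4^{-k} j, 4^{-k} (j+1))`. -/
def cell (k : ℕ) (j : ℤ) : Set ℝ :=
  Set.Ico ((j : ℝ) / 4 ^ k) (((j : ℝ) + 1) / 4 ^ k)

/-- The event `A_{k,j} = {σ_ε(u)⁻¹ (S_u + ε) ∈ [4^{-k} j, 4^{-k} (j+1))}`. -/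
def eventA (P : Measure Ω) (X : ℕ → Ω → ℝ) (τ : ℕ → ℕ) (ε : ℕ → Ω → ℝ)
    (k : ℕ) (j : ℤ) (n : ℕ) : Set Ω :=
  {ω | (perturbedScale P X τ ε n)⁻¹ * (firstBlock P X τ n ω + ε n ω) ∈ cell k j}

/-- The event `B_{k,j} = {σ_ε(u)⁻¹ (S'_u + ε') ∈ [4^{-k} j, 4^{-k} (j+1))}`, normalized by
the same `σ_ε(u)` as `A_{k,j}`. -/
def eventB (P : Measure Ω) (X : ℕ → Ω → ℝ) (τ : ℕ → ℕ) (ε ε' : ℕ → Ω → ℝ)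
    (k : ℕ) (j : ℤ) (n : ℕ) : Set Ω :=
  {ω | (perturbedScale P X τ ε n)⁻¹ * (lastBlock P X τ n ω + ε' n ω) ∈ cell k j}

/-- The limit relation of `H_S` for given perturbations: `P(A_{k,j}) - P(B_{k,j}) → 0`. -/
def ProbCondS (P : Measure Ω) (X : ℕ → Ω → ℝ) (τ : ℕ → ℕ) (ε ε' : ℕ → Ω → ℝ) : Prop :=
  ∀ (k : ℕ) (j : ℤ), Tendsto (fun n : ℕ =>
    P.real (eventA P X τ ε k j n) - P.real (eventB P X τ ε ε' k j n)) atTop (𝓝 0)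

/-- The limit relation of `H_I` for given perturbations:
`P(A_{k,j} ∩ B_{k,j'}) - P(A_{k,j}) P(B_{k,j'}) → 0`. -/
def ProbCondI (P : Measure Ω) (X : ℕ → Ω → ℝ) (τ : ℕ → ℕ) (ε ε' : ℕ → Ω → ℝ) : Prop :=
  ∀ (k : ℕ) (j j' : ℤ), Tendsto (fun n : ℕ =>
    P.real (eventA P X τ ε k j n ∩ eventB P X τ ε ε' k j' n) -
      P.real (eventA P X τ ε k j n) * P.real (eventB P X τ ε ε' k j' n)) atTop (𝓝 0)

/-- Perturbations allowed in `H_S` and `H_I`: centred, square integrable, with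
`E[εₙ²] + E[ε'ₙ²] → 0`. -/
structure IsCentredPerturbation (P : Measure Ω) (ε ε' : ℕ → Ω → ℝ) : Prop where
  measurable_left : ∀ n, Measurable (ε n)
  measurable_right : ∀ n, Measurable (ε' n)
  memLp_left : ∀ n, MemLp (ε n) 2 P
  memLp_right : ∀ n, MemLp (ε' n) 2 P
  mean_left : ∀ n, ∫ ω, ε n ω ∂P = 0
  mean_right : ∀ n, ∫ ω, ε' n ω ∂P = 0
  tendsto_sq : Tendsto (fun n : ℕ => (∫ ω, ε n ω ^ 2 ∂P) + ∫ ω, ε' n ω ^ 2 ∂P) atTop (𝓝 0)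

/-- Conditions `H_S` and `H_I` hold (for a common pair of centred perturbations). -/
def CondsSI (P : Measure Ω) (X : ℕ → Ω → ℝ) (τ : ℕ → ℕ) : Prop :=
  ∃ ε ε' : ℕ → Ω → ℝ, IsCentredPerturbation P ε ε' ∧
    ProbCondS P X τ ε ε' ∧ ProbCondI P X τ ε ε'

end Sums

/-- `μ_p`, the `p`-th moment of the standard normal law. -/
def gaussianMoment (p : ℕ) : ℝ := ∫ x, x ^ p ∂(gaussianReal 0 1)

end BlockCLT

end

/-! Write `W n` for the normalized sum of the first n variables. Cutting the sum into blocks gives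
`W n = r n * (Y n + Z n + η n)`, where `Y`, `Z` are the perturbed outer blocks, `η` is the middle
block minus both perturbations, and `r n = σ(u)/σ(n)`. Moreover `Y n` is close to `W (u n)`, with `u
n < n` for n ≥ 2. This structure, `BlockRecursion`, carries the whole argument.

Since `W n` has variance one and `Y`, `Z` are asymptotically uncorrelated of variance one, `r n ^ 2
→ 1/2` (`tendsto_scale_sq`). Expanding the power 2p and factorizing mixed moments, the moment of `W
n` is about `2 * 2^(-p)` times that of `W (u n)`, plus terms controlled by lower orders. For p ≥ 2
this contracts, so by induction all moments are bounded (`momentBounded`).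

Bounded moments make small terms negligible in every moment. The moment of order p then satisfies a
linear recursion with factor `2 * 2^(-p/2)`, up to o(1), once the lower moments converge. The normal
law satisfies the exact version, because it is stable under the scaled sum of two independent
copies. For p ≥ 3 the factor is below one and the difference tends to 0 (`tendsto_integral_pow`);
orders 0, 1, 2 are fixed by normalization.

Factorization gives the mixed moments. The normal law has exponential moments, so the method of
moments yields convergence in law, and cells have Gaussian-null boundary, hence `H_S` and `H_I`.
Dropping the perturbations changes no limit of moments, so the centred choice `U = V = 0` works too.
-/

noncomputable section

namespace BlockCLT

section

/-! ### The method of moments -/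

/-- The derivative of the remainder of order n + 1 is `I` times the remainder of order n, so the
bound integrates by induction from the trivial bound 1. -/
lemma norm_exp_mul_I_sub_sum_le_of_nonneg (n : ℕ) {x : ℝ} (hx : 0 ≤ x) :
    ‖Complex.exp (x * Complex.I) - ∑ k ∈ Finset.range n, (x * Complex.I) ^ k / k.factorial‖ ≤
      x ^ n / n.factorial := by
  induction n generalizing x with
  | zero => simp [Complex.norm_exp_ofReal_mul_I]
  | succ n ih =>
    have hderiv : ∀ y : ℝ, HasDerivAt (fun y : ℝ => Complex.exp (y * Complex.I) -
        ∑ k ∈ Finset.range (n + 1), (y * Complex.I) ^ k / k.factorial)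
        (Complex.I * (Complex.exp (y * Complex.I) -
          ∑ k ∈ Finset.range n, (y * Complex.I) ^ k / k.factorial)) y := by
      intro y
      have h0 : HasDerivAt (fun y : ℝ => (y : ℂ) * Complex.I) Complex.I y := by
        simpa using (Complex.ofRealCLM.hasDerivAt (x := y)).mul_const Complex.I
      have h1 := h0.cexp
      have h2 : ∀ k ∈ Finset.range n, HasDerivAt
          (fun y : ℝ => ((y : ℂ) * Complex.I) ^ (k + 1) / (k + 1).factorial)
          (Complex.I * ((y * Complex.I) ^ k / k.factorial)) y := by
        intro k _
        refine ((h0.fun_pow (k + 1)).div_const ((k + 1).factorial : ℂ)).congr_deriv ?_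
        have : (k.factorial : ℂ) ≠ 0 := by exact_mod_cast k.factorial_ne_zero
        have h' : (k : ℂ) + 1 ≠ 0 := by exact_mod_cast k.succ_ne_zero
        push_cast [Nat.factorial_succ]
        field_simp
      have h3 := (h1.fun_sub (HasDerivAt.fun_sum h2)).sub_const (1 : ℂ)
      refine (h3.congr_deriv ?_).congr_of_eventuallyEq (Eventually.of_forall fun y => ?_)
      · rw [← Finset.mul_sum]
        ring
      · simp only [Finset.sum_range_succ', Nat.factorial_zero, pow_zero, Nat.cast_one]
        ring
    have hB : ∀ y : ℝ, HasDerivAt (fun y : ℝ => y ^ (n + 1) / (n + 1).factorial)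
        (y ^ n / n.factorial) y := by
      intro y
      refine ((hasDerivAt_pow (n + 1) y).div_const ((n + 1).factorial : ℝ)).congr_deriv ?_
      have : (n.factorial : ℝ) ≠ 0 := by exact_mod_cast n.factorial_ne_zero
      have h' : (n : ℝ) + 1 ≠ 0 := by exact_mod_cast n.succ_ne_zero
      push_cast [Nat.factorial_succ]
      field_simp
    refine image_norm_le_of_norm_deriv_right_le_deriv_boundary (a := 0) (b := x)
      (f := fun y : ℝ => Complex.exp (y * Complex.I) -
        ∑ k ∈ Finset.range (n + 1), (y * Complex.I) ^ k / k.factorial)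
      (B := fun y : ℝ => y ^ (n + 1) / (n + 1).factorial)
      (fun y _ => (hderiv y).continuousAt.continuousWithinAt)
      (fun y _ => (hderiv y).hasDerivWithinAt) ?_ hB ?_ (Set.right_mem_Icc.2 hx)
    · simp [Finset.sum_range_succ']
    · intro y hy
      simpa using ih hy.1

/-- Taylor's estimate for `x ↦ exp (i x)`. -/
lemma norm_exp_mul_I_sub_sum_le (n : ℕ) (x : ℝ) :
    ‖Complex.exp (x * Complex.I) - ∑ k ∈ Finset.range n, (x * Complex.I) ^ k / k.factorial‖ ≤
      |x| ^ n / n.factorial := by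
  rcases le_total 0 x with hx | hx
  · simpa [abs_of_nonneg hx] using norm_exp_mul_I_sub_sum_le_of_nonneg n hx
  · have h := norm_exp_mul_I_sub_sum_le_of_nonneg n (neg_nonneg.2 hx)
    rw [abs_of_nonpos hx]
    convert h using 1
    -- Conjugation replaces x by -x.
    rw [← Complex.norm_conj]
    congr 1
    simp [← Complex.exp_conj]

variable {Ω Ω' : Type*} [MeasurableSpace Ω] [MeasurableSpace Ω']

/-- Integrated Taylor estimate. The order is even so that the error is a genuine moment, not an
absolute one, and its convergence is known. -/
lemma norm_integral_exp_mul_I_sub_sum_le {P : Measure Ω} [IsProbabilityMeasure P] {f : Ω → ℝ}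
    (hf : AEStronglyMeasurable f P) (hint : ∀ k : ℕ, Integrable (fun ω => f ω ^ k) P) (r : ℕ) :
    ‖(∫ ω, Complex.exp (f ω * Complex.I) ∂P) -
      ∑ k ∈ Finset.range (2 * r), ((∫ ω, f ω ^ k ∂P : ℝ) : ℂ) * (Complex.I ^ k / k.factorial)‖ ≤
      (∫ ω, f ω ^ (2 * r) ∂P) / (2 * r).factorial := by
  have hc : AEStronglyMeasurable (fun ω => ((f ω : ℝ) : ℂ)) P :=
    Complex.continuous_ofReal.comp_aestronglyMeasurable hf
  have hexp : Integrable (fun ω => Complex.exp (f ω * Complex.I)) P := by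
    refine (integrable_const (1 : ℝ)).mono'
      (Complex.continuous_exp.comp_aestronglyMeasurable (hc.mul_const _)) (ae_of_all _ fun ω => ?_)
    simp [Complex.norm_exp_ofReal_mul_I]
  have hk : ∀ k : ℕ, Integrable
      (fun ω => ((f ω ^ k : ℝ) : ℂ) * (Complex.I ^ k / k.factorial)) P :=
    fun k => (hint k).ofReal.mul_const _
  have hsum : ∑ k ∈ Finset.range (2 * r), ((∫ ω, f ω ^ k ∂P : ℝ) : ℂ) *
      (Complex.I ^ k / k.factorial) =
      ∫ ω, ∑ k ∈ Finset.range (2 * r), ((f ω ^ k : ℝ) : ℂ) * (Complex.I ^ k / k.factorial) ∂P := by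
    rw [integral_finsetSum _ fun k _ => hk k]
    refine Finset.sum_congr rfl fun k _ => ?_
    rw [integral_mul_const, integral_complex_ofReal]
  rw [hsum, ← integral_sub hexp (integrable_finsetSum _ fun k _ => hk k), ← integral_div]
  refine (norm_integral_le_integral_norm _).trans
    (integral_mono_of_nonneg (ae_of_all _ fun _ => norm_nonneg _) ((hint _).div_const _)
      (ae_of_all _ fun ω => ?_))
  have h := norm_exp_mul_I_sub_sum_le (2 * r) (f ω)
  rw [(even_two_mul r).pow_abs] at h
  refine le_of_eq_of_le (congrArg _ (congrArg _ (Finset.sum_congr rfl fun k _ => ?_))) h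
  push_cast
  ring

lemma integrable_pow_of_integrable_exp_abs {P : Measure Ω} {f : Ω → ℝ}
    (hf : AEStronglyMeasurable f P) (hexp : Integrable (fun ω => Real.exp |f ω|) P) (k : ℕ) :
    Integrable (fun ω => f ω ^ k) P := by
  refine (hexp.const_mul (k.factorial : ℝ)).mono' (hf.pow k) (ae_of_all _ fun ω => ?_)
  have hk : (0 : ℝ) < k.factorial := by exact_mod_cast k.factorial_pos
  have h := Real.pow_div_factorial_le_exp |f ω| (abs_nonneg _) k
  rw [div_le_iff₀ hk] at h
  rw [norm_pow, Real.norm_eq_abs]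
  linarith

/-- Dominated convergence with bound `exp |f|`. This makes the Taylor remainder of the limit
variable arbitrarily small. -/
lemma tendsto_integral_pow_div_factorial {P : Measure Ω} {f : Ω → ℝ}
    (hf : AEStronglyMeasurable f P) (hexp : Integrable (fun ω => Real.exp |f ω|) P) :
    Tendsto (fun k : ℕ => (∫ ω, f ω ^ k ∂P) / k.factorial) atTop (𝓝 0) := by
  have h : Tendsto (fun k : ℕ => ∫ ω, f ω ^ k / k.factorial ∂P) atTop (𝓝 (∫ _, (0 : ℝ) ∂P)) := by
    refine tendsto_integral_of_dominated_convergence (fun ω => Real.exp |f ω|)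
      (fun k => by fun_prop) hexp (fun k => ae_of_all _ fun ω => ?_)
      (ae_of_all _ fun ω => FloorSemiring.tendsto_pow_div_factorial_atTop (f ω))
    rw [norm_div, norm_pow, Real.norm_eq_abs, Real.norm_natCast]
    exact Real.pow_div_factorial_le_exp |f ω| (abs_nonneg _) k
  simpa [integral_div] using h

/-- If the moments of `f n` converge to those of a variable with exponential moments, then so does
the value at `1` of the characteristic functions. -/
lemma tendsto_integral_exp_mul_I_of_tendsto_moments {P : Measure Ω} [IsProbabilityMeasure P]
    {Q : Measure Ω'} [IsProbabilityMeasure Q] {f : ℕ → Ω → ℝ} {g : Ω' → ℝ}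
    (hf : ∀ n, AEStronglyMeasurable (f n) P)
    (hint : ∀ n k : ℕ, Integrable (fun ω => f n ω ^ k) P)
    (hg : AEStronglyMeasurable g Q) (hexp : Integrable (fun ω => Real.exp |g ω|) Q)
    (hlim : ∀ k : ℕ, Tendsto (fun n => ∫ ω, f n ω ^ k ∂P) atTop (𝓝 (∫ ω, g ω ^ k ∂Q))) :
    Tendsto (fun n => ∫ ω, Complex.exp (f n ω * Complex.I) ∂P) atTop
      (𝓝 (∫ ω, Complex.exp (g ω * Complex.I) ∂Q)) := by
  rw [Metric.tendsto_atTop']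
  intro δ hδ
  have h2 : Tendsto (fun r : ℕ => 2 * r) atTop atTop := tendsto_id.const_mul_atTop' two_pos
  -- The order r is chosen from `g` alone; convergence of the moment of order 2r then transfers the
  -- bound δ/3 to the remainder of `f n` for large n.
  obtain ⟨r, hr⟩ := (((tendsto_integral_pow_div_factorial hg hexp).comp h2).eventually
    (gt_mem_nhds (show 0 < δ / 3 by positivity))).exists
  have hr : (∫ ω, g ω ^ (2 * r) ∂Q) / (2 * r).factorial < δ / 3 := hr
  have e1 := ((hlim (2 * r)).div_const ((2 * r).factorial : ℝ)).eventually (gt_mem_nhds hr)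
  have hsum : Tendsto (fun n => ∑ k ∈ Finset.range (2 * r),
      ((∫ ω, f n ω ^ k ∂P : ℝ) : ℂ) * (Complex.I ^ k / k.factorial)) atTop
      (𝓝 (∑ k ∈ Finset.range (2 * r),
        ((∫ ω, g ω ^ k ∂Q : ℝ) : ℂ) * (Complex.I ^ k / k.factorial))) :=
    tendsto_finsetSum _ fun k _ =>
      ((Complex.continuous_ofReal.tendsto _).comp (hlim k)).mul_const _
  have e2 := (Metric.tendsto_nhds.1 hsum) (δ / 3) (by positivity)
  obtain ⟨N, hN⟩ := eventually_atTop.1 (e1.and e2)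
  refine ⟨N, fun n hn => ?_⟩
  obtain ⟨h1, h2⟩ := hN n hn.le
  have h3 := norm_integral_exp_mul_I_sub_sum_le (hf n) (hint n) r
  have h4 := norm_integral_exp_mul_I_sub_sum_le hg (integrable_pow_of_integrable_exp_abs hg hexp) r
  rw [dist_eq_norm] at h2 ⊢
  rw [norm_sub_rev] at h4
  set a := ∑ k ∈ Finset.range (2 * r), ((∫ ω, f n ω ^ k ∂P : ℝ) : ℂ) * (Complex.I ^ k / k.factorial)
  set b := ∑ k ∈ Finset.range (2 * r), ((∫ ω, g ω ^ k ∂Q : ℝ) : ℂ) * (Complex.I ^ k / k.factorial)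
  set x := ∫ ω, Complex.exp (f n ω * Complex.I) ∂P
  set y := ∫ ω, Complex.exp (g ω * Complex.I) ∂Q
  calc ‖x - y‖ = ‖(x - a) + (a - b) + (b - y)‖ := by congr 1; ring
    _ ≤ ‖x - a‖ + ‖a - b‖ + ‖b - y‖ := norm_add₃_le
    _ < δ := by linarith

/-- The method of moments in the plane. -/
theorem tendstoInDistribution_of_tendsto_moments {P : Measure Ω} [IsProbabilityMeasure P]
    {ν : Measure (ℝ × ℝ)} [IsProbabilityMeasure ν] {Y Z : ℕ → Ω → ℝ}
    (hY : ∀ n, AEMeasurable (Y n) P) (hZ : ∀ n, AEMeasurable (Z n) P)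
    (hint : ∀ n p q : ℕ, Integrable (fun ω => Y n ω ^ p * Z n ω ^ q) P)
    (hexp : ∀ s t : ℝ, Integrable (fun x : ℝ × ℝ => Real.exp |s * x.1 + t * x.2|) ν)
    (hlim : ∀ p q : ℕ, Tendsto (fun n => ∫ ω, Y n ω ^ p * Z n ω ^ q ∂P) atTop
      (𝓝 (∫ x, x.1 ^ p * x.2 ^ q ∂ν)))
    (hintν : ∀ p q : ℕ, Integrable (fun x : ℝ × ℝ => x.1 ^ p * x.2 ^ q) ν) :
    TendstoInDistribution (fun n ω => (Y n ω, Z n ω)) atTop (id : ℝ × ℝ → ℝ × ℝ)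
      (fun _ => P) ν := by
  -- Characteristic functions need an inner product, so the pair is carried to the Euclidean plane
  -- and back.
  have hmeas : ∀ n, AEMeasurable (fun ω => WithLp.toLp 2 (Y n ω, Z n ω)) P := fun n =>
    (WithLp.measurable_toLp 2 (ℝ × ℝ)).comp_aemeasurable ((hY n).prodMk (hZ n))
  have hν : AEMeasurable (fun x : ℝ × ℝ => WithLp.toLp 2 x) ν :=
    (WithLp.measurable_toLp 2 (ℝ × ℝ)).aemeasurable
  have key : TendstoInDistribution (fun n ω => WithLp.toLp 2 (Y n ω, Z n ω)) atTop
      (fun x : ℝ × ℝ => WithLp.toLp 2 x) (fun _ => P) ν := by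
    refine ⟨hmeas, hν, ProbabilityMeasure.tendsto_iff_tendsto_charFun.2 fun t => ?_⟩
    -- Cramér–Wold: only the linear form given by t matters, and its moments are combinations of
    -- mixed moments.
    have hexpand : ∀ (y z : ℝ) (k : ℕ), (t.fst * y + t.snd * z) ^ k =
        ∑ j ∈ Finset.range (k + 1),
          (t.fst ^ j * t.snd ^ (k - j) * (k.choose j)) * (y ^ j * z ^ (k - j)) := by
      intro y z k
      rw [add_pow]
      refine Finset.sum_congr rfl fun j _ => ?_
      rw [mul_pow, mul_pow]
      ring
    have h1 : ∀ n, charFun (P.map (fun ω => WithLp.toLp 2 (Y n ω, Z n ω))) t =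
        ∫ ω, Complex.exp ((t.fst * Y n ω + t.snd * Z n ω : ℝ) * Complex.I) ∂P := by
      intro n
      rw [charFun_apply, integral_map (hmeas n) (by fun_prop)]
      simp [WithLp.prod_inner_apply]
    have h2 : charFun (ν.map (fun x : ℝ × ℝ => WithLp.toLp 2 x)) t =
        ∫ x, Complex.exp ((t.fst * x.1 + t.snd * x.2 : ℝ) * Complex.I) ∂ν := by
      rw [charFun_apply, integral_map hν (by fun_prop)]
      simp [WithLp.prod_inner_apply]
    simp only [ProbabilityMeasure.coe_mk]
    simp_rw [h1, h2]
    have hint' : ∀ n k : ℕ, ∀ j ∈ Finset.range (k + 1), Integrable (fun ω =>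
        (t.fst ^ j * t.snd ^ (k - j) * (k.choose j)) * (Y n ω ^ j * Z n ω ^ (k - j))) P :=
      fun n k j _ => (hint n j (k - j)).const_mul _
    have hintν' : ∀ k : ℕ, ∀ j ∈ Finset.range (k + 1), Integrable (fun x : ℝ × ℝ =>
        (t.fst ^ j * t.snd ^ (k - j) * (k.choose j)) * (x.1 ^ j * x.2 ^ (k - j))) ν :=
      fun k j _ => (hintν j (k - j)).const_mul _
    refine tendsto_integral_exp_mul_I_of_tendsto_moments
      (fun n => (((hY n).const_mul _).add ((hZ n).const_mul _)).aestronglyMeasurable)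
      (fun n k => ?_) (by fun_prop) (hexp _ _) (fun k => ?_)
    · simp_rw [hexpand]
      exact integrable_finsetSum _ (hint' n k)
    · simp_rw [hexpand, integral_finsetSum _ (hint' _ k), integral_finsetSum _ (hintν' k),
        integral_const_mul]
      exact tendsto_finsetSum _ fun j _ => (hlim j (k - j)).const_mul _
  exact key.continuous_comp (WithLp.prod_continuous_ofLp 2 ℝ ℝ)

end

section

/-! ### Variables with finite moments, bounded and small sequences -/

variable {Ω : Type*} [MeasurableSpace Ω] {P : Measure Ω}

/-- All absolute moments of `f` are finite. -/
structure HasMoments (P : Measure Ω) (f : Ω → ℝ) : Prop where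
  aestronglyMeasurable : AEStronglyMeasurable f P
  integrable_abs_pow : ∀ p : ℕ, Integrable (fun ω => |f ω| ^ p) P

lemma abs_add_pow_le (a b : ℝ) (p : ℕ) : |a + b| ^ p ≤ 2 ^ p * (|a| ^ p + |b| ^ p) := by
  have h : |a + b| ≤ 2 * max |a| |b| :=
    (abs_add_le a b).trans (by linarith [le_max_left |a| |b|, le_max_right |a| |b|])
  calc |a + b| ^ p ≤ (2 * max |a| |b|) ^ p := pow_le_pow_left₀ (abs_nonneg _) h p
    _ = 2 ^ p * (max |a| |b|) ^ p := mul_pow _ _ _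
    _ ≤ 2 ^ p * (|a| ^ p + |b| ^ p) := by
      gcongr
      rcases max_choice |a| |b| with h | h <;> rw [h]
      · linarith [pow_nonneg (abs_nonneg b) p]
      · linarith [pow_nonneg (abs_nonneg a) p]

namespace HasMoments

variable {f g : Ω → ℝ}

lemma add (hf : HasMoments P f) (hg : HasMoments P g) : HasMoments P (fun ω => f ω + g ω) := by
  have hm := hf.1.add hg.1
  refine ⟨hm, fun p => (((hf.2 p).add (hg.2 p)).const_mul (2 ^ p)).mono' (hm.norm.pow p)
    (ae_of_all _ fun ω => ?_)⟩
  rw [norm_pow, Real.norm_eq_abs, abs_abs]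
  exact abs_add_pow_le _ _ p

lemma mul (hf : HasMoments P f) (hg : HasMoments P g) : HasMoments P (fun ω => f ω * g ω) := by
  have hm := hf.1.mul hg.1
  refine ⟨hm, fun p => ((hf.2 (2 * p)).add (hg.2 (2 * p))).mono' (hm.norm.pow p)
    (ae_of_all _ fun ω => ?_)⟩
  rw [norm_pow, Real.norm_eq_abs, abs_abs, abs_mul, mul_pow]
  simp only [Pi.add_apply, pow_mul']
  nlinarith [sq_nonneg (|f ω| ^ p - |g ω| ^ p), sq_nonneg (|f ω| ^ p), sq_nonneg (|g ω| ^ p)]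

lemma integrable (hf : HasMoments P f) : Integrable f P := by
  have h := hf.2 1
  simp only [pow_one] at h
  exact (integrable_norm_iff hf.1).1 h

lemma integrable_mul (hf : HasMoments P f) (hg : HasMoments P g) :
    Integrable (fun ω => f ω * g ω) P := (hf.mul hg).integrable

variable [IsProbabilityMeasure P]

lemma const (c : ℝ) : HasMoments P (fun _ => c) :=
  ⟨aestronglyMeasurable_const, fun _ => integrable_const _⟩

lemma const_mul (hf : HasMoments P f) (c : ℝ) : HasMoments P (fun ω => c * f ω) :=
  (const c).mul hf

lemma div_const (hf : HasMoments P f) (c : ℝ) : HasMoments P (fun ω => f ω / c) := by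
  simpa [div_eq_inv_mul] using hf.const_mul c⁻¹

lemma neg (hf : HasMoments P f) : HasMoments P (fun ω => -f ω) := by
  simpa using hf.const_mul (-1)

lemma sub (hf : HasMoments P f) (hg : HasMoments P g) : HasMoments P (fun ω => f ω - g ω) := by
  simpa [sub_eq_add_neg] using hf.add hg.neg

lemma pow (hf : HasMoments P f) (p : ℕ) : HasMoments P (fun ω => f ω ^ p) := by
  induction p with
  | zero => simpa using const 1
  | succ p ih => simpa [pow_succ] using ih.mul hf

lemma sum {ι : Type*} {s : Finset ι} {f : ι → Ω → ℝ} (hf : ∀ i ∈ s, HasMoments P (f i)) :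
    HasMoments P (fun ω => ∑ i ∈ s, f i ω) := by
  classical
  induction s using Finset.induction_on with
  | empty => simpa using const 0
  | insert a s ha ih =>
    simp only [Finset.sum_insert ha]
    exact (hf a (Finset.mem_insert_self _ _)).add
      (ih fun i hi => hf i (Finset.mem_insert_of_mem hi))

lemma integrable_pow (hf : HasMoments P f) (p : ℕ) : Integrable (fun ω => f ω ^ p) P :=
  (hf.pow p).integrable

lemma integral_add_sq (hf : HasMoments P f) (hg : HasMoments P g) :
    ∫ ω, (f ω + g ω) ^ 2 ∂P =
      (∫ ω, f ω ^ 2 ∂P) + 2 * (∫ ω, f ω * g ω ∂P) + ∫ ω, g ω ^ 2 ∂P := by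
  have h : ∀ ω, (f ω + g ω) ^ 2 = f ω ^ 2 + 2 * (f ω * g ω) + g ω ^ 2 := fun ω => by ring
  have h1 : Integrable (fun ω => 2 * (f ω * g ω)) P := (hf.integrable_mul hg).const_mul 2
  have h2 : Integrable (fun ω => f ω ^ 2 + 2 * (f ω * g ω)) P := (hf.integrable_pow 2).add h1
  simp_rw [h]
  rw [integral_add h2 (hg.integrable_pow 2), integral_add (hf.integrable_pow 2) h1,
    integral_const_mul]

/-- The Cauchy-Schwarz inequality. -/
lemma sq_integral_mul_le (hf : HasMoments P f) (hg : HasMoments P g) :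
    (∫ ω, f ω * g ω ∂P) ^ 2 ≤ (∫ ω, f ω ^ 2 ∂P) * ∫ ω, g ω ^ 2 ∂P := by
  have h : ∀ x : ℝ, 0 ≤ (∫ ω, g ω ^ 2 ∂P) * (x * x) + (2 * ∫ ω, f ω * g ω ∂P) * x +
      ∫ ω, f ω ^ 2 ∂P := by
    intro x
    have h0 : 0 ≤ ∫ ω, (f ω + x * g ω) ^ 2 ∂P := integral_nonneg fun ω => sq_nonneg _
    rw [hf.integral_add_sq (hg.const_mul x)] at h0
    simp only [mul_pow, mul_left_comm _ x, integral_const_mul] at h0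
    linarith
  have := discrim_le_zero h
  rw [discrim] at this
  linarith

lemma sq_integral_le (hf : HasMoments P f) : (∫ ω, f ω ∂P) ^ 2 ≤ ∫ ω, f ω ^ 2 ∂P := by
  simpa using hf.sq_integral_mul_le (const 1)

end HasMoments

/-- If `E xₙ²` is bounded and `E yₙ² → 0` then `E xₙ yₙ → 0`. -/
lemma tendsto_integral_mul_zero [IsProbabilityMeasure P] {x y : ℕ → Ω → ℝ}
    (hx : ∀ n, HasMoments P (x n)) (hy : ∀ n, HasMoments P (y n)) {C : ℝ}
    (hC : ∀ᶠ n in atTop, ∫ ω, x n ω ^ 2 ∂P ≤ C)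
    (h0 : Tendsto (fun n => ∫ ω, y n ω ^ 2 ∂P) atTop (𝓝 0)) :
    Tendsto (fun n => ∫ ω, x n ω * y n ω ∂P) atTop (𝓝 0) := by
  have h1 : Tendsto (fun n => (∫ ω, x n ω * y n ω ∂P) ^ 2) atTop (𝓝 0) := by
    refine squeeze_zero' (Eventually.of_forall fun n => sq_nonneg _) ?_
      (by simpa using h0.const_mul C)
    filter_upwards [hC] with n hn
    exact ((hx n).sq_integral_mul_le (hy n)).trans
      (mul_le_mul_of_nonneg_right hn (integral_nonneg fun ω => sq_nonneg _))
  have h2 := (Real.continuous_sqrt.tendsto 0).comp h1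
  simp only [Function.comp_def, Real.sqrt_sq_eq_abs, Real.sqrt_zero] at h2
  exact (tendsto_zero_iff_abs_tendsto_zero _).2 h2

lemma tendsto_integral_add_sq [IsProbabilityMeasure P] {x y : ℕ → Ω → ℝ}
    (hx : ∀ n, HasMoments P (x n)) (hy : ∀ n, HasMoments P (y n)) {a : ℝ}
    (ha : Tendsto (fun n => ∫ ω, x n ω ^ 2 ∂P) atTop (𝓝 a))
    (h0 : Tendsto (fun n => ∫ ω, y n ω ^ 2 ∂P) atTop (𝓝 0)) :
    Tendsto (fun n => ∫ ω, (x n ω + y n ω) ^ 2 ∂P) atTop (𝓝 a) := by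
  simp_rw [fun n => (hx n).integral_add_sq (hy n)]
  have hC : ∀ᶠ n in atTop, ∫ ω, x n ω ^ 2 ∂P ≤ a + 1 :=
    (ha.eventually (gt_mem_nhds (lt_add_one a))).mono fun n hn => hn.le
  simpa using (ha.add ((tendsto_integral_mul_zero hx hy hC h0).const_mul 2)).add h0

/-- Every even moment of the sequence is bounded. -/
structure MomentBounded (P : Measure Ω) (f : ℕ → Ω → ℝ) : Prop where
  hasMoments : ∀ n, HasMoments P (f n)
  bounded : ∀ p : ℕ, ∃ C, ∀ n, ∫ ω, f n ω ^ (2 * p) ∂P ≤ C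

/-- Every even moment of positive order tends to zero. -/
structure MomentSmall (P : Measure Ω) (f : ℕ → Ω → ℝ) : Prop where
  hasMoments : ∀ n, HasMoments P (f n)
  tendsto : ∀ p : ℕ, 1 ≤ p → Tendsto (fun n => ∫ ω, f n ω ^ (2 * p) ∂P) atTop (𝓝 0)

lemma integral_even_pow_nonneg (f : Ω → ℝ) (p : ℕ) : 0 ≤ ∫ ω, f ω ^ (2 * p) ∂P :=
  integral_nonneg fun _ => (even_two_mul p).pow_nonneg _

variable {f g : ℕ → Ω → ℝ}

lemma MomentBounded.comp (hf : MomentBounded P f) (u : ℕ → ℕ) :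
    MomentBounded P (fun n => f (u n)) :=
  ⟨fun _ => hf.1 _, fun p => (hf.2 p).imp fun _ hC _ => hC _⟩

variable [IsProbabilityMeasure P]

lemma HasMoments.integral_add_even_pow_le {f g : Ω → ℝ} (hf : HasMoments P f)
    (hg : HasMoments P g) (p : ℕ) : ∫ ω, (f ω + g ω) ^ (2 * p) ∂P ≤
      2 ^ (2 * p) * ((∫ ω, f ω ^ (2 * p) ∂P) + ∫ ω, g ω ^ (2 * p) ∂P) := by
  rw [← integral_add (hf.integrable_pow _) (hg.integrable_pow _), ← integral_const_mul]
  refine integral_mono ((hf.add hg).integrable_pow _)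
    (((hf.integrable_pow _).add (hg.integrable_pow _)).const_mul _) fun ω => ?_
  have h := abs_add_pow_le (f ω) (g ω) (2 * p)
  simpa only [(even_two_mul p).pow_abs] using h

lemma MomentBounded.add (hf : MomentBounded P f) (hg : MomentBounded P g) :
    MomentBounded P (fun n ω => f n ω + g n ω) := by
  refine ⟨fun n => (hf.1 n).add (hg.1 n), fun p => ?_⟩
  obtain ⟨C, hC⟩ := hf.2 p
  obtain ⟨D, hD⟩ := hg.2 p
  refine ⟨2 ^ (2 * p) * (C + D), fun n => ((hf.1 n).integral_add_even_pow_le (hg.1 n) p).trans ?_⟩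
  gcongr
  exacts [hC n, hD n]

lemma MomentBounded.mul (hf : MomentBounded P f) (hg : MomentBounded P g) :
    MomentBounded P (fun n ω => f n ω * g n ω) := by
  refine ⟨fun n => (hf.1 n).mul (hg.1 n), fun p => ?_⟩
  obtain ⟨C, hC⟩ := hf.2 (2 * p)
  obtain ⟨D, hD⟩ := hg.2 (2 * p)
  refine ⟨C + D, fun n => le_trans ?_ (add_le_add (hC n) (hD n))⟩
  rw [← integral_add ((hf.1 n).integrable_pow _) ((hg.1 n).integrable_pow _)]
  refine integral_mono (((hf.1 n).mul (hg.1 n)).integrable_pow _)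
    (((hf.1 n).integrable_pow _).add ((hg.1 n).integrable_pow _)) fun ω => ?_
  simp only [mul_pow, pow_mul' _ 2 (2 * p)]
  nlinarith [sq_nonneg (f n ω ^ (2 * p) - g n ω ^ (2 * p)), sq_nonneg (f n ω ^ (2 * p)),
    sq_nonneg (g n ω ^ (2 * p))]

lemma MomentBounded.of_bounded_const {c : ℕ → ℝ} {C : ℝ} (hc : ∀ n, |c n| ≤ C) :
    MomentBounded P (fun n _ => c n) := by
  refine ⟨fun n => HasMoments.const _, fun p => ⟨C ^ (2 * p), fun n => ?_⟩⟩
  rw [integral_const]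
  simp only [probReal_univ, one_smul]
  rw [← (even_two_mul p).pow_abs]
  exact pow_le_pow_left₀ (abs_nonneg _) (hc n) _

lemma MomentBounded.pow (hf : MomentBounded P f) (p : ℕ) :
    MomentBounded P (fun n ω => f n ω ^ p) := by
  induction p with
  | zero => simpa using MomentBounded.of_bounded_const (P := P) (c := fun _ => 1) (C := 1) (by simp)
  | succ p ih => simpa [pow_succ] using ih.mul hf

/-- The means of a moment bounded sequence are bounded. -/
lemma MomentBounded.exists_abs_integral_le (hf : MomentBounded P f) :
    ∃ C, ∀ n, |∫ ω, f n ω ∂P| ≤ C := by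
  obtain ⟨C, hC⟩ := hf.2 1
  refine ⟨C + 1, fun n => ?_⟩
  have h := (hf.1 n).sq_integral_le.trans (hC n)
  rw [← sq_abs] at h
  nlinarith [abs_nonneg (∫ ω, f n ω ∂P), sq_nonneg (|∫ ω, f n ω ∂P| - 1)]

lemma MomentSmall.momentBounded (hf : MomentSmall P f) : MomentBounded P f := by
  refine ⟨hf.1, fun p => ?_⟩
  rcases Nat.eq_zero_or_pos p with rfl | hp
  · exact ⟨1, fun n => by simp⟩
  · obtain ⟨C, hC⟩ := (hf.2 p hp).bddAbove_range
    exact ⟨C, fun n => hC (Set.mem_range_self n)⟩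

lemma MomentSmall.add (hf : MomentSmall P f) (hg : MomentSmall P g) :
    MomentSmall P (fun n ω => f n ω + g n ω) := by
  refine ⟨fun n => (hf.1 n).add (hg.1 n), fun p hp => ?_⟩
  refine squeeze_zero (fun n => integral_even_pow_nonneg _ p)
    (fun n => (hf.1 n).integral_add_even_pow_le (hg.1 n) p) ?_
  simpa using ((hf.2 p hp).add (hg.2 p hp)).const_mul (2 ^ (2 * p))

lemma MomentSmall.neg (hf : MomentSmall P f) : MomentSmall P (fun n ω => -f n ω) := by
  refine ⟨fun n => (hf.1 n).neg, fun p hp => ?_⟩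
  simpa only [(even_two_mul p).neg_pow] using hf.2 p hp

lemma MomentSmall.sub (hf : MomentSmall P f) (hg : MomentSmall P g) :
    MomentSmall P (fun n ω => f n ω - g n ω) := by
  simpa only [sub_eq_add_neg] using hf.add hg.neg

/-- Cauchy–Schwarz for the powers of order 2p: the moments of order 4p of `f` are bounded and those
of `g` vanish in the limit. -/
lemma MomentBounded.mul_small (hf : MomentBounded P f) (hg : MomentSmall P g) :
    MomentSmall P (fun n ω => f n ω * g n ω) := by
  refine ⟨fun n => (hf.1 n).mul (hg.1 n), fun p hp => ?_⟩
  obtain ⟨C, hC⟩ := hf.2 (2 * p)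
  simp only [mul_pow]
  refine tendsto_integral_mul_zero (fun n => (hf.1 n).pow _) (fun n => (hg.1 n).pow _) (C := C)
    (Eventually.of_forall fun n => ?_) ?_
  · simpa only [← pow_mul, mul_comm (2 * p) 2] using hC n
  · simpa only [← pow_mul, mul_comm (2 * p) 2] using hg.2 (2 * p) (by omega)

lemma MomentSmall.tendsto_integral (hf : MomentSmall P f) :
    Tendsto (fun n => ∫ ω, f n ω ∂P) atTop (𝓝 0) := by
  have h := tendsto_integral_mul_zero (P := P) (x := fun _ _ => 1) (C := 1)
    (fun _ => HasMoments.const 1) hf.1 (by simp) (by simpa using hf.2 1 le_rfl)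
  simpa using h

/-- Induction through `f^(p+1) - g^(p+1) = f (f^p - g^p) + g^p (f - g)`. -/
lemma MomentSmall.pow_sub_pow (hf : MomentBounded P f) (hg : MomentBounded P g)
    (h : MomentSmall P (fun n ω => f n ω - g n ω)) (p : ℕ) :
    MomentSmall P (fun n ω => f n ω ^ p - g n ω ^ p) := by
  induction p with
  | zero =>
    refine ⟨fun n => ((hf.1 n).pow 0).sub ((hg.1 n).pow 0), fun p hp => ?_⟩
    simp [show p ≠ 0 by omega]
  | succ p ih =>
    have := (hf.mul_small ih).add ((hg.pow p).mul_small h)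
    refine ⟨fun n => ((hf.1 n).pow _).sub ((hg.1 n).pow _), ?_⟩
    convert this.2 using 7
    ring

/-- Small perturbations do not change mixed moments in the limit. -/
lemma tendsto_integral_mul_pow_sub {f' g' : ℕ → Ω → ℝ}
    (hf : MomentBounded P f) (hf' : MomentBounded P f')
    (hg : MomentBounded P g) (hg' : MomentBounded P g')
    (h : MomentSmall P (fun n ω => f n ω - f' n ω))
    (h' : MomentSmall P (fun n ω => g n ω - g' n ω)) (p q : ℕ) :
    Tendsto (fun n => (∫ ω, f n ω ^ p * g n ω ^ q ∂P) - ∫ ω, f' n ω ^ p * g' n ω ^ q ∂P)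
      atTop (𝓝 0) := by
  -- The difference is split as `f^p (g^q - g'^q) + g'^q (f^p - f'^p)`.
  have h1 := ((hf.pow p).mul_small (MomentSmall.pow_sub_pow hg hg' h' q)).add
    ((hg'.pow q).mul_small (MomentSmall.pow_sub_pow hf hf' h p))
  refine h1.tendsto_integral.congr fun n => ?_
  rw [← integral_sub (((hf.1 n).pow p).integrable_mul ((hg.1 n).pow q))
    (((hf'.1 n).pow p).integrable_mul ((hg'.1 n).pow q))]
  congr 1
  funext ω
  ring

lemma tendsto_integral_pow_sub {f' : ℕ → Ω → ℝ}
    (hf : MomentBounded P f) (hf' : MomentBounded P f')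
    (h : MomentSmall P (fun n ω => f n ω - f' n ω)) (p : ℕ) :
    Tendsto (fun n => (∫ ω, f n ω ^ p ∂P) - ∫ ω, f' n ω ^ p ∂P) atTop (𝓝 0) := by
  simpa using tendsto_integral_mul_pow_sub hf hf' hf hf' h h p 0

end

section

/-! ### Recursive inequalities -/

/-- Any bound at least `C / (1 - ρ)`, the fixed point of `x ↦ ρ x + C`, is inherited from `u n` by
n. -/
lemma exists_forall_le_of_le_mul_add {b : ℕ → ℝ} {u : ℕ → ℕ} {ρ C : ℝ} {N : ℕ}
    (hρ0 : 0 ≤ ρ) (hρ1 : ρ < 1) (hu : ∀ n, N ≤ n → u n < n)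
    (hb : ∀ n, N ≤ n → b n ≤ ρ * b (u n) + C) : ∃ M, ∀ n, b n ≤ M := by
  obtain ⟨M₀, hM₀⟩ := ((Set.finite_lt_nat N).image b).bddAbove
  refine ⟨max M₀ (C / (1 - ρ)), fun n => ?_⟩
  induction n using Nat.strong_induction_on with
  | _ n ih =>
    rcases lt_or_ge n N with hn | hn
    · exact le_max_of_le_left (hM₀ ⟨n, hn, rfl⟩)
    · have h1 := ih (u n) (hu n hn)
      have h2 := (div_le_iff₀ (by linarith : 0 < 1 - ρ)).1 (le_max_right M₀ (C / (1 - ρ)))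
      have h3 := mul_le_mul_of_nonneg_left h1 hρ0
      linarith [hb n hn]

/-- The recursion is iterated k times with k fixed, leaving `ρ ^ k * M` and an accumulated error δ.
A one-step error below `(1 - ρ) * δ` keeps δ unchanged under iteration. -/
lemma tendsto_zero_of_sub_mul_comp {e : ℕ → ℝ} {u : ℕ → ℕ} {ρ M : ℝ}
    (hρ0 : 0 ≤ ρ) (hρ1 : ρ < 1) (hu : Tendsto u atTop atTop) (hM : ∀ n, |e n| ≤ M)
    (h : Tendsto (fun n => e n - ρ * e (u n)) atTop (𝓝 0)) : Tendsto e atTop (𝓝 0) := by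
  have key : ∀ δ > 0, ∀ k : ℕ, ∀ᶠ n in atTop, |e n| ≤ ρ ^ k * M + δ := by
    intro δ hδ k
    induction k with
    | zero => exact Eventually.of_forall fun n => by simpa using (hM n).trans (by linarith)
    | succ k ih =>
      have h1 := h.abs.eventually (gt_mem_nhds (show |(0 : ℝ)| < (1 - ρ) * δ by
        rw [abs_zero]; exact mul_pos (by linarith) hδ))
      filter_upwards [hu.eventually ih, h1] with n hn hn1
      have h2 : |e n| ≤ |e n - ρ * e (u n)| + ρ * |e (u n)| := by
        have := abs_add_le (e n - ρ * e (u n)) (ρ * e (u n))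
        rwa [sub_add_cancel, abs_mul, abs_of_nonneg hρ0] at this
      have h3 := mul_le_mul_of_nonneg_left hn hρ0
      rw [pow_succ']
      nlinarith
  rw [tendsto_zero_iff_abs_tendsto_zero, Metric.tendsto_nhds]
  intro δ hδ
  have h1 : Tendsto (fun k : ℕ => ρ ^ k * M) atTop (𝓝 0) := by
    simpa using (tendsto_pow_atTop_nhds_zero_of_lt_one hρ0 hρ1).mul_const M
  obtain ⟨k, hk⟩ := (h1.eventually (gt_mem_nhds (half_pos hδ))).exists
  filter_upwards [key (δ / 3) (by positivity) k] with n hn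
  simp only [Function.comp_apply, Real.dist_eq, sub_zero, abs_abs]
  linarith

/-- Either `|b| ≤ κ |a|`, with κ so small that `(1 + κ)^(2m) < 9/8`, or `|a| ≤ κ⁻¹ |b|`. A
coefficient of `a` near 1 is essential: the factor `2^(2m)` of `abs_add_pow_le` would destroy the
contraction. -/
lemma exists_even_pow_add_le (m : ℕ) : ∃ C : ℝ, 0 ≤ C ∧ ∀ a b : ℝ,
    (a + b) ^ (2 * m) ≤ 9 / 8 * a ^ (2 * m) + C * b ^ (2 * m) := by
  have hc : Tendsto (fun κ : ℝ => (1 + κ) ^ (2 * m)) (𝓝[>] 0) (𝓝 1) := by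
    have : Continuous fun κ : ℝ => (1 + κ) ^ (2 * m) := by fun_prop
    simpa using (this.tendsto 0).mono_left nhdsWithin_le_nhds
  obtain ⟨κ, hκ, hκ0⟩ := ((hc.eventually (gt_mem_nhds (show (1 : ℝ) < 9 / 8 by norm_num))).and
    self_mem_nhdsWithin).exists
  have hκ0 : 0 < κ := hκ0
  refine ⟨(κ⁻¹ + 1) ^ (2 * m), by positivity, fun a b => ?_⟩
  rw [← (even_two_mul m).pow_abs (a + b), ← (even_two_mul m).pow_abs a,
    ← (even_two_mul m).pow_abs b]
  have ha := pow_nonneg (abs_nonneg a) (2 * m)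
  have hb := pow_nonneg (abs_nonneg b) (2 * m)
  rcases le_total |b| (κ * |a|) with h | h
  · have h1 : |a + b| ≤ (1 + κ) * |a| := (abs_add_le a b).trans (by linarith)
    have h2 := pow_le_pow_left₀ (abs_nonneg _) h1 (2 * m)
    rw [mul_pow] at h2
    have h3 : 0 ≤ (κ⁻¹ + 1) ^ (2 * m) * |b| ^ (2 * m) := by positivity
    have h4 := mul_le_mul_of_nonneg_right hκ.le ha
    linarith
  · have h0 : |a| ≤ κ⁻¹ * |b| := by
      rw [inv_mul_eq_div, le_div_iff₀ hκ0]; linarith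
    have h1 : |a + b| ≤ (κ⁻¹ + 1) * |b| := (abs_add_le a b).trans (by linarith)
    have h2 := pow_le_pow_left₀ (abs_nonneg _) h1 (2 * m)
    rw [mul_pow] at h2
    linarith

/-! ### Moments of the standard normal law -/

lemma integrable_exp_abs_gaussianReal (s : ℝ) :
    Integrable (fun x : ℝ => Real.exp |s * x|) (gaussianReal 0 1) := by
  refine ((integrable_exp_mul_gaussianReal (μ := 0) (v := 1) s).add
    (integrable_exp_mul_gaussianReal (μ := 0) (v := 1) (-s))).mono' (by fun_prop)
    (ae_of_all _ fun x => ?_)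
  rw [Real.norm_eq_abs, Real.abs_exp]
  simp only [Pi.add_apply]
  rcases abs_choice (s * x) with h | h <;> rw [h]
  · linarith [Real.exp_pos (-s * x)]
  · rw [← neg_mul]; linarith [Real.exp_pos (s * x)]

lemma integrable_exp_abs_gaussianReal_prod (s t : ℝ) :
    Integrable (fun x : ℝ × ℝ => Real.exp |s * x.1 + t * x.2|)
      ((gaussianReal 0 1).prod (gaussianReal 0 1)) := by
  refine ((integrable_exp_abs_gaussianReal s).mul_prod (integrable_exp_abs_gaussianReal t)).mono'
    (by fun_prop) (ae_of_all _ fun x => ?_)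
  rw [Real.norm_eq_abs, Real.abs_exp, ← Real.exp_add]
  exact Real.exp_le_exp.2 (abs_add_le _ _)

lemma integrable_pow_gaussianReal (p : ℕ) :
    Integrable (fun x : ℝ => x ^ p) (gaussianReal 0 1) :=
  integrable_pow_of_integrable_exp_abs (by fun_prop)
    (by simpa using integrable_exp_abs_gaussianReal 1) p

lemma integrable_pow_mul_pow_gaussianReal_prod (p q : ℕ) :
    Integrable (fun x : ℝ × ℝ => x.1 ^ p * x.2 ^ q)
      ((gaussianReal 0 1).prod (gaussianReal 0 1)) :=
  (integrable_pow_gaussianReal p).mul_prod (integrable_pow_gaussianReal q)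

lemma integral_pow_mul_pow_gaussianReal_prod (p q : ℕ) :
    ∫ x : ℝ × ℝ, x.1 ^ p * x.2 ^ q ∂((gaussianReal 0 1).prod (gaussianReal 0 1)) =
      gaussianMoment p * gaussianMoment q :=
  integral_prod_mul (μ := gaussianReal 0 1) (ν := gaussianReal 0 1)
    (fun x : ℝ => x ^ p) (fun x : ℝ => x ^ q)

lemma gaussianMoment_zero : gaussianMoment 0 = 1 := by simp [gaussianMoment]

lemma gaussianMoment_one : gaussianMoment 1 = 0 := by
  simp [gaussianMoment, integral_id_gaussianReal]

lemma gaussianMoment_two : gaussianMoment 2 = 1 := by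
  have h := variance_fun_id_gaussianReal (μ := 0) (v := 1)
  rw [variance_eq_integral (by fun_prop), integral_id_gaussianReal] at h
  simpa [gaussianMoment] using h

/-- The moments of the normal law reproduce under the scaled sum of two independent copies. -/
lemma gaussianMoment_eq {c : ℝ} (hc : c ^ 2 = 1 / 2) (p : ℕ) :
    gaussianMoment p = c ^ p * ∑ i ∈ Finset.range (p + 1),
      gaussianMoment i * gaussianMoment (p - i) * (p.choose i) := by
  have hlaw : ((gaussianReal 0 1).prod (gaussianReal 0 1)).map
      (fun x : ℝ × ℝ => c * (x.1 + x.2)) = gaussianReal 0 1 := by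
    have h1 : ((gaussianReal 0 1).prod (gaussianReal 0 1)).map
        (fun x : ℝ × ℝ => x.1 + x.2) = gaussianReal 0 2 := by
      have := gaussianReal_conv_gaussianReal (m₁ := 0) (m₂ := 0) (v₁ := 1) (v₂ := 1)
      rw [add_zero, one_add_one_eq_two] at this
      exact this
    have h2 := gaussianReal_map_const_mul (μ := 0) (v := 2) c
    rw [← h1, Measure.map_map (by fun_prop) (by fun_prop)] at h2
    have h3 : NNReal.mk (c ^ 2) (sq_nonneg c) * 2 = 1 := by
      apply NNReal.eq
      simp [hc]
    rw [h3, mul_zero] at h2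
    exact h2
  have hexp : ∀ x : ℝ × ℝ, (c * (x.1 + x.2)) ^ p = c ^ p * ∑ i ∈ Finset.range (p + 1),
      (x.1 ^ i * x.2 ^ (p - i)) * (p.choose i) := fun x => by rw [mul_pow, add_pow]
  calc gaussianMoment p = ∫ x, x ^ p ∂(((gaussianReal 0 1).prod (gaussianReal 0 1)).map
        (fun x : ℝ × ℝ => c * (x.1 + x.2))) := by rw [hlaw]; rfl
    _ = ∫ x : ℝ × ℝ, (c * (x.1 + x.2)) ^ p ∂((gaussianReal 0 1).prod (gaussianReal 0 1)) :=
      integral_map (by fun_prop) (by fun_prop)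
    _ = _ := by
      simp_rw [hexp]
      rw [integral_const_mul, integral_finsetSum _ fun i _ =>
        (integrable_pow_mul_pow_gaussianReal_prod i (p - i)).mul_const _]
      simp_rw [integral_mul_const, integral_pow_mul_pow_gaussianReal_prod]

end

section

variable {Ω : Type*} [MeasurableSpace Ω]

/-! ### Moments along a block recursion -/

/-- Centred variables `W n` of variance one such that `W n` is, up to a scale and a small term, the
sum of two variables `Y n`, `Z n` with asymptotically equal and factorizing moments, the first of
which is close to `W (u n)` with `u n < n`. -/
structure BlockRecursion (P : Measure Ω) (W Y Z η : ℕ → Ω → ℝ) (u : ℕ → ℕ) (r : ℕ → ℝ) :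
    Prop where
  hasMoments : ∀ n, HasMoments P (W n)
  hasMoments_right : ∀ n, HasMoments P (Z n)
  small_left : MomentSmall P (fun n ω => Y n ω - W (u n) ω)
  small_middle : MomentSmall P η
  lt_self : ∀ n, 2 ≤ n → u n < n
  one_le : ∀ n, 1 ≤ u n
  tendsto_atTop : Tendsto u atTop atTop
  nonneg : ∀ n, 0 ≤ r n
  eq_mul : ∀ n, 2 ≤ n → ∀ ω, W n ω = r n * (Y n ω + Z n ω + η n ω)
  integral_eq_zero : ∀ n, ∫ ω, W n ω ∂P = 0
  integral_sq_eq_one : ∀ n, 1 ≤ n → ∫ ω, W n ω ^ 2 ∂P = 1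
  tendsto_sub : ∀ p : ℕ, Tendsto (fun n => (∫ ω, Y n ω ^ p ∂P) - ∫ ω, Z n ω ^ p ∂P) atTop (𝓝 0)
  tendsto_factor : ∀ p q : ℕ, 1 ≤ p → 1 ≤ q → Tendsto (fun n =>
    (∫ ω, Y n ω ^ p * Z n ω ^ q ∂P) - (∫ ω, Y n ω ^ p ∂P) * ∫ ω, Z n ω ^ q ∂P) atTop (𝓝 0)

lemma HasMoments.integral_add_pow {P : Measure Ω} [IsProbabilityMeasure P] {f g : Ω → ℝ}
    (hf : HasMoments P f) (hg : HasMoments P g) (p : ℕ) :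
    ∫ ω, (f ω + g ω) ^ p ∂P =
      ∑ i ∈ Finset.range (p + 1), (∫ ω, f ω ^ i * g ω ^ (p - i) ∂P) * (p.choose i) := by
  simp_rw [add_pow]
  rw [integral_finsetSum _ fun i _ =>
    ((hf.pow i).integrable_mul (hg.pow (p - i))).mul_const _]
  simp_rw [integral_mul_const]

lemma HasMoments.abs_integral_pow_le {P : Measure Ω} [IsProbabilityMeasure P] {f : Ω → ℝ}
    (hf : HasMoments P f) {i q : ℕ} (h : i ≤ 2 * q) :
    |∫ ω, f ω ^ i ∂P| ≤ 1 + ∫ ω, f ω ^ (2 * q) ∂P := by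
  have h1 : ∫ ω, (1 + f ω ^ (2 * q)) ∂P = 1 + ∫ ω, f ω ^ (2 * q) ∂P := by
    rw [integral_add (integrable_const _) (hf.integrable_pow _)]
    simp
  rw [← h1]
  refine abs_integral_le_integral_abs.trans (integral_mono (hf.integrable_pow i).abs
    ((integrable_const _).add (hf.integrable_pow _)) fun ω => ?_)
  simp only [abs_pow, ← (even_two_mul q).pow_abs (f ω)]
  rcases le_total |f ω| 1 with h' | h'
  · linarith [pow_le_one₀ (n := i) (abs_nonneg (f ω)) h', pow_nonneg (abs_nonneg (f ω)) (2 * q)]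
  · linarith [pow_le_pow_right₀ h' h]

namespace BlockRecursion

variable {P : Measure Ω} {W Y Z η : ℕ → Ω → ℝ} {u : ℕ → ℕ} {r : ℕ → ℝ}

lemma hasMoments_left (h : BlockRecursion P W Y Z η u r) (n : ℕ) : HasMoments P (Y n) := by
  simpa using (h.small_left.1 n).add (h.hasMoments (u n))

variable [IsProbabilityMeasure P]

lemma tendsto_integral_left (h : BlockRecursion P W Y Z η u r) :
    Tendsto (fun n => ∫ ω, Y n ω ∂P) atTop (𝓝 0) := by
  refine h.small_left.tendsto_integral.congr fun n => ?_
  rw [integral_sub (h.hasMoments_left n).integrable (h.hasMoments _).integrable,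
    h.integral_eq_zero, sub_zero]

lemma tendsto_integral_right (h : BlockRecursion P W Y Z η u r) :
    Tendsto (fun n => ∫ ω, Z n ω ∂P) atTop (𝓝 0) := by
  simpa using h.tendsto_integral_left.sub (h.tendsto_sub 1)

lemma tendsto_integral_sq_left (h : BlockRecursion P W Y Z η u r) :
    Tendsto (fun n => ∫ ω, Y n ω ^ 2 ∂P) atTop (𝓝 1) := by
  have h1 := tendsto_integral_add_sq (fun n => h.hasMoments (u n)) h.small_left.1 (a := 1)
    (by simp [h.integral_sq_eq_one _ (h.one_le _)]) (h.small_left.2 1 le_rfl)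
  simpa using h1

lemma tendsto_integral_sq_right (h : BlockRecursion P W Y Z η u r) :
    Tendsto (fun n => ∫ ω, Z n ω ^ 2 ∂P) atTop (𝓝 1) := by
  simpa using h.tendsto_integral_sq_left.sub (h.tendsto_sub 2)

/-- By normalization `1 = r² E(Y + Z + η)²`. Factorization at p = q = 1 and vanishing means remove
the cross term, so the expectation tends to 2. -/
lemma tendsto_scale_sq (h : BlockRecursion P W Y Z η u r) :
    Tendsto (fun n => r n ^ 2) atTop (𝓝 (1 / 2)) := by
  have hYZ : Tendsto (fun n => ∫ ω, Y n ω * Z n ω ∂P) atTop (𝓝 0) := by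
    simpa using (h.tendsto_factor 1 1 le_rfl le_rfl).add
      (h.tendsto_integral_left.mul h.tendsto_integral_right)
  have h1 : Tendsto (fun n => ∫ ω, (Y n ω + Z n ω) ^ 2 ∂P) atTop (𝓝 2) := by
    simp_rw [fun n => (h.hasMoments_left n).integral_add_sq (h.hasMoments_right n)]
    convert (h.tendsto_integral_sq_left.add (hYZ.const_mul 2)).add h.tendsto_integral_sq_right
      using 2
    norm_num
  have h2 := tendsto_integral_add_sq (fun n => (h.hasMoments_left n).add (h.hasMoments_right n))
    h.small_middle.1 h1 (h.small_middle.2 1 le_rfl)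
  have h3 := h2.inv₀ two_ne_zero
  rw [← one_div] at h3
  refine h3.congr' ?_
  filter_upwards [eventually_ge_atTop 2] with n hn
  have h4 := h.integral_sq_eq_one n (by omega)
  simp_rw [h.eq_mul n hn, mul_pow, integral_const_mul] at h4
  exact (eq_inv_of_mul_eq_one_left h4).symm

lemma tendsto_scale (h : BlockRecursion P W Y Z η u r) :
    Tendsto r atTop (𝓝 √(1 / 2)) := by
  refine ((Real.continuous_sqrt.tendsto _).comp h.tendsto_scale_sq).congr fun n => ?_
  exact Real.sqrt_sq (h.nonneg n)

/-- The moments of order `2 p` of the two summands are controlled by the moment of the first one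
and the moments of lower order. -/
lemma eventually_integral_mul_le (h : BlockRecursion P W Y Z η u r) {p : ℕ}
    (hp : 1 ≤ p) (hlow : ∀ q < p, ∃ C, ∀ n, ∫ ω, W n ω ^ (2 * q) ∂P ≤ C) {i j : ℕ} (hi : 1 ≤ i)
    (hj : 1 ≤ j) (hij : i + j = 2 * p) {δ : ℝ} (hδ : 0 < δ) :
    ∃ D, ∀ᶠ n in atTop,
      ∫ ω, Y n ω ^ i * Z n ω ^ j ∂P ≤ δ * (∫ ω, Y n ω ^ (2 * p) ∂P) + D := by
  have hYlow : ∃ C, ∀ n, ∫ ω, Y n ω ^ (2 * (p - 1)) ∂P ≤ C := by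
    obtain ⟨C, hC⟩ := hlow (p - 1) (by omega)
    obtain ⟨C', hC'⟩ := h.small_left.momentBounded.2 (p - 1)
    refine ⟨2 ^ (2 * (p - 1)) * (C' + C), fun n => ?_⟩
    have h1 := (h.small_left.1 n).integral_add_even_pow_le (h.hasMoments (u n)) (p - 1)
    simp only [sub_add_cancel] at h1
    refine h1.trans ?_
    gcongr
    exacts [hC' n, hC _]
  obtain ⟨C, hC⟩ := hYlow
  have hfac := (h.tendsto_factor i j hi hj).eventually (gt_mem_nhds zero_lt_one)
  have hsub : ∀ q : ℕ, ∀ᶠ n in atTop, ∫ ω, Z n ω ^ q ∂P ≤ (∫ ω, Y n ω ^ q ∂P) + 1 := fun q => by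
    filter_upwards [(h.tendsto_sub q).eventually (lt_mem_nhds (neg_lt_zero.2 zero_lt_one))]
      with n hn
    linarith
  -- If one exponent is 1, the other is 2p - 1, beyond the orders already bounded; the mean of the
  -- linear factor, eventually below δ, pays for it. Otherwise both exponents are at most 2p - 2 and
  -- both moments are bounded.
  rcases Nat.lt_or_ge i 2 with hi2 | hi2
  · obtain rfl : i = 1 := by omega
    refine ⟨δ * 2 + 1, ?_⟩
    filter_upwards [hfac, hsub (2 * p), h.tendsto_integral_left.abs.eventually
      (gt_mem_nhds (show |(0 : ℝ)| < δ by simpa using hδ))] with n h1 h2 h3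
    have h4 := (h.hasMoments_right n).abs_integral_pow_le (show j ≤ 2 * p by omega)
    simp only [pow_one] at h1 ⊢
    have h5 := le_abs_self ((∫ ω, Y n ω ∂P) * ∫ ω, Z n ω ^ j ∂P)
    rw [abs_mul] at h5
    have h6 := mul_le_mul h3.le (h4.trans (add_le_add_right h2 1)) (abs_nonneg _) hδ.le
    linarith
  rcases Nat.lt_or_ge j 2 with hj2 | hj2
  · obtain rfl : j = 1 := by omega
    refine ⟨δ + 1, ?_⟩
    filter_upwards [hfac, h.tendsto_integral_right.abs.eventually
      (gt_mem_nhds (show |(0 : ℝ)| < δ by simpa using hδ))] with n h1 h3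
    have h4 := (h.hasMoments_left n).abs_integral_pow_le (show i ≤ 2 * p by omega)
    simp only [pow_one] at h1 ⊢
    have h5 := le_abs_self ((∫ ω, Y n ω ^ i ∂P) * ∫ ω, Z n ω ∂P)
    rw [abs_mul] at h5
    have h6 := mul_le_mul h4 h3.le (abs_nonneg _) ((abs_nonneg _).trans h4)
    linarith
  · refine ⟨(1 + C) * (1 + (C + 1)) + 1, ?_⟩
    filter_upwards [hfac, hsub (2 * (p - 1))] with n h1 h2
    have h3 := (h.hasMoments_left n).abs_integral_pow_le (show i ≤ 2 * (p - 1) by omega)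
    have h4 := (h.hasMoments_right n).abs_integral_pow_le (show j ≤ 2 * (p - 1) by omega)
    have h5 := le_abs_self ((∫ ω, Y n ω ^ i ∂P) * ∫ ω, Z n ω ^ j ∂P)
    rw [abs_mul] at h5
    have hCn := hC n
    have h6 : |∫ ω, Y n ω ^ i ∂P| ≤ 1 + C := by linarith
    have h7 := mul_le_mul h6 (show |∫ ω, Z n ω ^ j ∂P| ≤ 1 + (C + 1) by linarith)
      (abs_nonneg _) ((abs_nonneg _).trans h6)
    have h8 := mul_nonneg hδ.le (integral_even_pow_nonneg (P := P) (Y n) p)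
    linarith

/-- The pure powers of `Y` and `Z` contribute 2 to the coefficient 9/4; the mixed terms contribute
the remaining 1/4. -/
lemma eventually_integral_add_pow_le (h : BlockRecursion P W Y Z η u r) {p : ℕ}
    (hp : 1 ≤ p) (hlow : ∀ q < p, ∃ C, ∀ n, ∫ ω, W n ω ^ (2 * q) ∂P ≤ C) :
    ∃ D, ∀ᶠ n in atTop, ∫ ω, (Y n ω + Z n ω) ^ (2 * p) ∂P ≤
      9 / 4 * (∫ ω, Y n ω ^ (2 * p) ∂P) + D := by
  -- The binomial coefficients sum to at most `2^(2p)`, so the mixed terms together cost at most a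
  -- quarter of the moment.
  set δ : ℝ := 1 / (4 * 2 ^ (2 * p)) with hδ
  have hδ0 : 0 < δ := by positivity
  have hterm : ∀ i, ∃ D, 0 ≤ D ∧ (i ∈ Finset.Ico 1 (2 * p) → ∀ᶠ n in atTop,
      ∫ ω, Y n ω ^ i * Z n ω ^ (2 * p - i) ∂P ≤ δ * (∫ ω, Y n ω ^ (2 * p) ∂P) + D) := by
    intro i
    by_cases hi : i ∈ Finset.Ico 1 (2 * p)
    · have hi' := Finset.mem_Ico.1 hi
      obtain ⟨D, hD⟩ := h.eventually_integral_mul_le hp hlow (i := i) (j := 2 * p - i)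
        (by omega) (by omega) (by omega) hδ0
      exact ⟨max D 0, le_max_right _ _, fun _ => hD.mono fun n hn =>
        hn.trans (add_le_add_right (le_max_left _ _) _)⟩
    · exact ⟨0, le_rfl, fun hi' => absurd hi' hi⟩
  choose D hD0 hD using hterm
  refine ⟨1 + ∑ i ∈ Finset.Ico 1 (2 * p), D i * ((2 * p).choose i), ?_⟩
  filter_upwards [(Filter.eventually_all_finset _).2 hD,
    (h.tendsto_sub (2 * p)).eventually (lt_mem_nhds (neg_lt_zero.2 zero_lt_one))] with n h1 h2
  rw [(h.hasMoments_left n).integral_add_pow (h.hasMoments_right n), Finset.sum_range_succ,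
    Finset.range_eq_Ico, Finset.sum_eq_sum_Ico_succ_bot (by omega)]
  simp only [pow_zero, one_mul, Nat.sub_zero, Nat.choose_zero_right, Nat.cast_one, mul_one,
    Nat.sub_self, Nat.choose_self, zero_add]
  set m := ∫ ω, Y n ω ^ (2 * p) ∂P with hm
  have hm0 : 0 ≤ m := integral_even_pow_nonneg (P := P) (Y n) p
  have h3 : ∑ i ∈ Finset.Ico 1 (2 * p),
      (∫ ω, Y n ω ^ i * Z n ω ^ (2 * p - i) ∂P) * ((2 * p).choose i) ≤
      ∑ i ∈ Finset.Ico 1 (2 * p), (δ * m + D i) * ((2 * p).choose i) :=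
    Finset.sum_le_sum fun i hi => mul_le_mul_of_nonneg_right (h1 i hi) (Nat.cast_nonneg _)
  have h4 : ∑ i ∈ Finset.Ico 1 (2 * p), ((2 * p).choose i : ℝ) ≤ 2 ^ (2 * p) := by
    have := Nat.sum_range_choose (2 * p)
    have h5 : ∑ i ∈ Finset.Ico 1 (2 * p), (2 * p).choose i ≤ 2 ^ (2 * p) := by
      rw [← this]
      refine Finset.sum_le_sum_of_subset fun i hi => ?_
      simp only [Finset.mem_Ico, Finset.mem_range] at hi ⊢
      omega
    exact_mod_cast h5
  simp only [add_mul, Finset.sum_add_distrib, ← Finset.mul_sum] at h3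
  have h5 := mul_le_mul_of_nonneg_left h4 (mul_nonneg hδ0.le hm0)
  have h6 : δ * m * 2 ^ (2 * p) = m / 4 := by rw [hδ]; field_simp
  linarith

/-- Strong induction on p. The limiting factor `2 * 2^(-p)` is at most 1/2 for p ≥ 2 but equals 1
for p = 1, where the variance normalization is used instead. -/
theorem momentBounded (h : BlockRecursion P W Y Z η u r) : MomentBounded P W := by
  refine ⟨h.hasMoments, fun p => ?_⟩
  induction p using Nat.strong_induction_on with
  | _ p ih =>
  rcases Nat.lt_or_ge p 2 with hp | hp
  · have hlim : Tendsto (fun n => ∫ ω, W n ω ^ (2 * p) ∂P) atTop (𝓝 1) := by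
      refine tendsto_const_nhds.congr' ?_
      filter_upwards [eventually_ge_atTop 1] with n hn
      interval_cases p
      · simp
      · exact (h.integral_sq_eq_one n hn).symm
    obtain ⟨C, hC⟩ := hlim.bddAbove_range
    exact ⟨C, fun n => hC (Set.mem_range_self n)⟩
  obtain ⟨D, hD⟩ := h.eventually_integral_add_pow_le (by omega) ih
  obtain ⟨K, hK0, hK⟩ := exists_even_pow_add_le p
  have hint : ∀ {f g : Ω → ℝ}, HasMoments P f → HasMoments P g →
      ∫ ω, (f ω + g ω) ^ (2 * p) ∂P ≤
        9 / 8 * (∫ ω, f ω ^ (2 * p) ∂P) + K * ∫ ω, g ω ^ (2 * p) ∂P := by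
    intro f g hf hg
    rw [← integral_const_mul, ← integral_const_mul, ← integral_add
      ((hf.integrable_pow _).const_mul _) ((hg.integrable_pow _).const_mul _)]
    exact integral_mono ((hf.add hg).integrable_pow _)
      (((hf.integrable_pow _).const_mul _).add ((hg.integrable_pow _).const_mul _))
      fun ω => hK _ _
  obtain ⟨A, hA⟩ := h.small_left.momentBounded.2 p
  obtain ⟨B, hB⟩ := h.small_middle.momentBounded.2 p
  have hscale := h.tendsto_scale_sq.eventually
    (gt_mem_nhds (show (1 / 2 : ℝ) < 9 / 16 by norm_num))
  obtain ⟨N, hN⟩ := eventually_atTop.1 ((hD.and hscale).and (eventually_ge_atTop 2))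
  -- The ratio is `81/256 * 729/256`: the first factor bounds `r^(2p)`, and the second is `9/8 * 9/4
  -- * 9/8`, from removing `η`, expanding `Y + Z`, and replacing `Y` by `W (u n)`. The absolute
  -- value in `C` makes the bracket nonnegative, so that `r^(2p)` may be enlarged.
  refine exists_forall_le_of_le_mul_add (ρ := 59049 / 65536)
    (C := 81 / 256 * |9 / 8 * (9 / 4 * (K * A) + D) + K * B|) (N := N) (u := u)
    (by norm_num) (by norm_num) (fun n hn => h.lt_self n (hN n hn).2) fun n hn => ?_
  obtain ⟨⟨h1, h2⟩, h3⟩ := hN n hn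
  have h4 := hint (h.hasMoments (u n)) (h.small_left.1 n)
  simp only [add_sub_cancel] at h4
  have h5 := hint ((h.hasMoments_left n).add (h.hasMoments_right n)) (h.small_middle.1 n)
  have h6 : r n ^ (2 * p) ≤ 81 / 256 := by
    calc r n ^ (2 * p) = (r n ^ 2) ^ p := pow_mul _ _ _
      _ ≤ (9 / 16) ^ p := pow_le_pow_left₀ (sq_nonneg _) h2.le p
      _ ≤ (9 / 16) ^ 2 := pow_le_pow_of_le_one (by norm_num) (by norm_num) hp
      _ = 81 / 256 := by norm_num
  have h7 : 0 ≤ r n ^ (2 * p) := (even_two_mul p).pow_nonneg _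
  have h8 : 0 ≤ ∫ ω, W (u n) ω ^ (2 * p) ∂P := integral_even_pow_nonneg _ p
  have h9 := mul_le_mul_of_nonneg_left (hA n) hK0
  have h10 := mul_le_mul_of_nonneg_left (hB n) hK0
  simp_rw [h.eq_mul n h3, mul_pow, integral_const_mul]
  set b := ∫ ω, W (u n) ω ^ (2 * p) ∂P
  have h11 := le_abs_self (9 / 8 * (9 / 4 * (K * A) + D) + K * B)
  calc r n ^ (2 * p) * ∫ ω, (Y n ω + Z n ω + η n ω) ^ (2 * p) ∂P
      ≤ r n ^ (2 * p) * (729 / 256 * b + |9 / 8 * (9 / 4 * (K * A) + D) + K * B|) := by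
        refine mul_le_mul_of_nonneg_left ?_ h7
        linarith
    _ ≤ 81 / 256 * (729 / 256 * b + |9 / 8 * (9 / 4 * (K * A) + D) + K * B|) := by
        refine mul_le_mul_of_nonneg_right h6 ?_
        positivity
    _ = _ := by ring

lemma momentBounded_left (h : BlockRecursion P W Y Z η u r) : MomentBounded P Y := by
  simpa using h.small_left.momentBounded.add (h.momentBounded.comp u)

lemma momentBounded_right (h : BlockRecursion P W Y Z η u r) : MomentBounded P Z := by
  refine ⟨h.hasMoments_right, fun p => ?_⟩
  obtain ⟨C, hC⟩ := h.momentBounded_left.2 p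
  obtain ⟨D, hD⟩ := (h.tendsto_sub (2 * p)).bddBelow_range
  refine ⟨C - D, fun n => ?_⟩
  have := hD (Set.mem_range_self n)
  linarith [hC n]

end BlockRecursion

end

/-! ### Convergence of moments to the Gaussian ones -/

section

variable {Ω : Type*} [MeasurableSpace Ω]

/-- The mixed moments of `(Y n, Z n)` converge to those of two independent standard normal
variables. -/
def MomentsTendstoGaussian (P : Measure Ω) (Y Z : ℕ → Ω → ℝ) : Prop :=
  ∀ p q : ℕ, Tendsto (fun n => ∫ ω, Y n ω ^ p * Z n ω ^ q ∂P) atTop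
    (𝓝 (gaussianMoment p * gaussianMoment q))

namespace BlockRecursion

variable {P : Measure Ω} [IsProbabilityMeasure P] {W Y Z η : ℕ → Ω → ℝ} {u : ℕ → ℕ} {r : ℕ → ℝ}

lemma tendsto_integral_pow_left_sub (h : BlockRecursion P W Y Z η u r) (p : ℕ) :
    Tendsto (fun n => (∫ ω, Y n ω ^ p ∂P) - ∫ ω, W (u n) ω ^ p ∂P) atTop (𝓝 0) :=
  tendsto_integral_pow_sub h.momentBounded_left (h.momentBounded.comp u) h.small_left p

lemma tendsto_integral_pow_right_sub (h : BlockRecursion P W Y Z η u r) (p : ℕ) :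
    Tendsto (fun n => (∫ ω, Z n ω ^ p ∂P) - ∫ ω, W (u n) ω ^ p ∂P) atTop (𝓝 0) := by
  simpa using (h.tendsto_integral_pow_left_sub p).sub (h.tendsto_sub p)

lemma tendsto_left_of_tendsto (h : BlockRecursion P W Y Z η u r) {p : ℕ} {a : ℝ}
    (ha : Tendsto (fun n => ∫ ω, W n ω ^ p ∂P) atTop (𝓝 a)) :
    Tendsto (fun n => ∫ ω, Y n ω ^ p ∂P) atTop (𝓝 a) := by
  simpa using (h.tendsto_integral_pow_left_sub p).add (ha.comp h.tendsto_atTop)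

lemma tendsto_right_of_tendsto (h : BlockRecursion P W Y Z η u r) {p : ℕ} {a : ℝ}
    (ha : Tendsto (fun n => ∫ ω, W n ω ^ p ∂P) atTop (𝓝 a)) :
    Tendsto (fun n => ∫ ω, Z n ω ^ p ∂P) atTop (𝓝 a) := by
  simpa using (h.tendsto_integral_pow_right_sub p).add (ha.comp h.tendsto_atTop)

lemma tendsto_mul_of_tendsto (h : BlockRecursion P W Y Z η u r) {p q : ℕ} (hp : 1 ≤ p)
    (hq : 1 ≤ q) {a b : ℝ}
    (ha : Tendsto (fun n => ∫ ω, W n ω ^ p ∂P) atTop (𝓝 a))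
    (hb : Tendsto (fun n => ∫ ω, W n ω ^ q ∂P) atTop (𝓝 b)) :
    Tendsto (fun n => ∫ ω, Y n ω ^ p * Z n ω ^ q ∂P) atTop (𝓝 (a * b)) := by
  simpa using (h.tendsto_factor p q hp hq).add
    ((h.tendsto_left_of_tendsto ha).mul (h.tendsto_right_of_tendsto hb))

/-- The moment of order `p` satisfies an asymptotic linear recursion, provided that the moments of
lower order converge. -/
lemma tendsto_integral_pow_sub_mul (h : BlockRecursion P W Y Z η u r) {p : ℕ} (hp : 1 ≤ p)
    (hlow : ∀ q < p, Tendsto (fun n => ∫ ω, W n ω ^ q ∂P) atTop (𝓝 (gaussianMoment q))) :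
    Tendsto (fun n => (∫ ω, W n ω ^ p ∂P) - 2 * √(1 / 2) ^ p * ∫ ω, W (u n) ω ^ p ∂P) atTop
      (𝓝 (gaussianMoment p - 2 * √(1 / 2) ^ p * gaussianMoment p)) := by
  set c : ℝ := √(1 / 2)
  have hc2 : c ^ 2 = 1 / 2 := Real.sq_sqrt (by norm_num)
  set S := ∑ i ∈ Finset.Ico 1 p, gaussianMoment i * gaussianMoment (p - i) * (p.choose i)
  -- The normal law solves the limiting recursion exactly; the end terms of the binomial sum give `2
  -- * gaussianMoment p`.
  have hS : gaussianMoment p = c ^ p * (2 * gaussianMoment p + S) := by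
    conv_lhs => rw [gaussianMoment_eq hc2 p]
    rw [Finset.sum_range_succ, Finset.range_eq_Ico, Finset.sum_eq_sum_Ico_succ_bot (by omega)]
    simp only [gaussianMoment_zero, Nat.choose_zero_right, Nat.choose_self, Nat.sub_self,
      Nat.sub_zero, Nat.cast_one, zero_add]
    ring
  -- Interior terms converge by `hlow`; the end terms, not yet known to converge, cancel
  -- asymptotically against `2 E W(u n)^p`.
  have hYZ : Tendsto (fun n => (∫ ω, (Y n ω + Z n ω) ^ p ∂P) - 2 * ∫ ω, W (u n) ω ^ p ∂P)
      atTop (𝓝 S) := by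
    have hmid : Tendsto (fun n => ∑ i ∈ Finset.Ico 1 p,
        (∫ ω, Y n ω ^ i * Z n ω ^ (p - i) ∂P) * (p.choose i)) atTop (𝓝 S) := by
      refine tendsto_finsetSum _ fun i hi => ?_
      rw [Finset.mem_Ico] at hi
      exact (h.tendsto_mul_of_tendsto hi.1 (by omega) (hlow i hi.2)
        (hlow (p - i) (by omega))).mul_const _
    have h1 := (hmid.add (h.tendsto_integral_pow_left_sub p)).add
      (h.tendsto_integral_pow_right_sub p)
    rw [add_zero, add_zero] at h1
    refine h1.congr fun n => ?_
    rw [(h.hasMoments_left n).integral_add_pow (h.hasMoments_right n), Finset.sum_range_succ,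
      Finset.range_eq_Ico, Finset.sum_eq_sum_Ico_succ_bot (show 0 < p by omega)]
    simp only [pow_zero, one_mul, Nat.sub_zero, Nat.choose_zero_right, Nat.cast_one, mul_one,
      Nat.sub_self, Nat.choose_self, zero_add]
    ring
  have hbdd := h.momentBounded_left.add h.momentBounded_right
  have hη : Tendsto (fun n => (∫ ω, (Y n ω + Z n ω + η n ω) ^ p ∂P) -
      ∫ ω, (Y n ω + Z n ω) ^ p ∂P) atTop (𝓝 0) :=
    tendsto_integral_pow_sub (hbdd.add h.small_middle.momentBounded) hbdd
      (by simpa using h.small_middle) p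
  have hr : Tendsto (fun n => r n ^ p) atTop (𝓝 (c ^ p)) := h.tendsto_scale.pow p
  obtain ⟨C, hC⟩ := ((h.momentBounded.comp u).pow p).exists_abs_integral_le
  -- Replacing `r n ^ p` by its limit requires only boundedness of the moment of order p.
  have herr : Tendsto (fun n => (r n ^ p - c ^ p) * ∫ ω, W (u n) ω ^ p ∂P) atTop (𝓝 0) := by
    have h0 : Tendsto (fun n => r n ^ p - c ^ p) atTop (𝓝 0) := by
      simpa using hr.sub_const (c ^ p)
    exact bdd_le_mul_tendsto_zero' C (Eventually.of_forall hC) h0 |>.congr fun n => mul_comm _ _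
  have h2 := (hr.mul (hη.add hYZ)).add (herr.const_mul 2)
  have hlim : c ^ p * (0 + S) + 2 * 0 = gaussianMoment p - 2 * c ^ p * gaussianMoment p := by
    linear_combination -hS
  rw [hlim] at h2
  refine h2.congr' ?_
  filter_upwards [eventually_ge_atTop 2] with n hn
  have h3 : ∫ ω, W n ω ^ p ∂P = r n ^ p * ∫ ω, (Y n ω + Z n ω + η n ω) ^ p ∂P := by
    simp_rw [h.eq_mul n hn, mul_pow, integral_const_mul]
  rw [h3]
  ring

/-- The moments of `W n` converge to those of the standard normal law. -/
theorem tendsto_integral_pow (h : BlockRecursion P W Y Z η u r) (p : ℕ) :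
    Tendsto (fun n => ∫ ω, W n ω ^ p ∂P) atTop (𝓝 (gaussianMoment p)) := by
  induction p using Nat.strong_induction_on with
  | _ p ih =>
  -- The factor `2 * 2^(-p/2)` drops below 1 only from p = 3 on; smaller orders are fixed by mean
  -- zero and variance one.
  rcases Nat.lt_or_ge p 3 with hp | hp
  · refine tendsto_const_nhds.congr' ?_
    filter_upwards [eventually_ge_atTop 1] with n hn
    interval_cases p
    · simp [gaussianMoment_zero]
    · simp [gaussianMoment_one, h.integral_eq_zero]
    · rw [gaussianMoment_two, h.integral_sq_eq_one n hn]
  have hrec := h.tendsto_integral_pow_sub_mul (by omega) ih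
  set c : ℝ := √(1 / 2)
  have hc0 : 0 ≤ c := Real.sqrt_nonneg _
  have hc2 : c ^ 2 = 1 / 2 := Real.sq_sqrt (by norm_num)
  have hc1 : c < 1 := by nlinarith
  have hρ : 2 * c ^ p < 1 := by
    have : c ^ p ≤ c ^ 3 := pow_le_pow_of_le_one hc0 hc1.le hp
    have h3 : c ^ 3 = c / 2 := by rw [pow_succ, hc2]; ring
    linarith
  obtain ⟨C, hC⟩ := (h.momentBounded.pow p).exists_abs_integral_le
  have key : Tendsto (fun n => (∫ ω, W n ω ^ p ∂P) - gaussianMoment p) atTop (𝓝 0) := by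
    refine tendsto_zero_of_sub_mul_comp (ρ := 2 * c ^ p) (M := C + |gaussianMoment p|)
      (u := u) (by positivity) hρ h.tendsto_atTop
      (fun n => (abs_sub _ _).trans (add_le_add_left (hC n) _)) ?_
    have h1 := hrec.sub_const (gaussianMoment p - 2 * c ^ p * gaussianMoment p)
    rw [sub_self] at h1
    refine h1.congr fun n => ?_
    ring
  simpa using key.add_const (gaussianMoment p)

theorem momentsTendstoGaussian (h : BlockRecursion P W Y Z η u r) :
    MomentsTendstoGaussian P Y Z := by
  intro p q
  rcases Nat.eq_zero_or_pos p with rfl | hp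
  · simpa [gaussianMoment_zero] using h.tendsto_right_of_tendsto (h.tendsto_integral_pow q)
  rcases Nat.eq_zero_or_pos q with rfl | hq
  · simpa [gaussianMoment_zero] using h.tendsto_left_of_tendsto (h.tendsto_integral_pow p)
  exact h.tendsto_mul_of_tendsto hp hq (h.tendsto_integral_pow p) (h.tendsto_integral_pow q)

end BlockRecursion

/-! ### From moments to laws and events -/

namespace MomentsTendstoGaussian

variable {P : Measure Ω} {Y Z : ℕ → Ω → ℝ}

/-- One factor serves both components because `eventA` and `eventB` share the same normalization. -/
lemma const_mul (h : MomentsTendstoGaussian P Y Z) {c : ℕ → ℝ} (hc : Tendsto c atTop (𝓝 1)) :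
    MomentsTendstoGaussian P (fun n ω => c n * Y n ω) (fun n ω => c n * Z n ω) := by
  intro p q
  have h1 := (hc.pow (p + q)).mul (h p q)
  rw [one_pow, one_mul] at h1
  refine h1.congr fun n => ?_
  rw [← integral_const_mul]
  congr 1
  funext ω
  ring

variable [IsProbabilityMeasure P]

lemma tendstoInDistribution (h : MomentsTendstoGaussian P Y Z)
    (hY : ∀ n, HasMoments P (Y n)) (hZ : ∀ n, HasMoments P (Z n)) :
    TendstoInDistribution (fun n ω => (Y n ω, Z n ω)) atTop (id : ℝ × ℝ → ℝ × ℝ)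
      (fun _ => P) ((gaussianReal 0 1).prod (gaussianReal 0 1)) :=
  tendstoInDistribution_of_tendsto_moments (fun n => (hY n).1.aemeasurable)
    (fun n => (hZ n).1.aemeasurable)
    (fun n p q => ((hY n).pow p).integrable_mul ((hZ n).pow q))
    integrable_exp_abs_gaussianReal_prod
    (fun p q => by rw [integral_pow_mul_pow_gaussianReal_prod]; exact h p q)
    integrable_pow_mul_pow_gaussianReal_prod

/-- Portmanteau for the rectangle `s ×ˢ t`, whose boundary is null for the product law. Taking one
side to be `univ` recovers the marginals. -/
lemma tendsto_measureReal_inter (h : MomentsTendstoGaussian P Y Z)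
    (hY : ∀ n, HasMoments P (Y n)) (hZ : ∀ n, HasMoments P (Z n)) {s t : Set ℝ}
    (hs : MeasurableSet s) (ht : MeasurableSet t)
    (hs0 : gaussianReal 0 1 (frontier s) = 0) (ht0 : gaussianReal 0 1 (frontier t) = 0) :
    Tendsto (fun n => P.real ({ω | Y n ω ∈ s} ∩ {ω | Z n ω ∈ t})) atTop
      (𝓝 ((gaussianReal 0 1).real s * (gaussianReal 0 1).real t)) := by
  have hd := h.tendstoInDistribution hY hZ
  have hfr : ((gaussianReal 0 1).prod (gaussianReal 0 1)) (frontier (s ×ˢ t)) = 0 := by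
    rw [frontier_prod_eq]
    refine measure_union_null ?_ ?_ <;> rw [Measure.prod_prod] <;> simp [hs0, ht0]
  have h1 := ProbabilityMeasure.tendsto_measure_of_null_frontier_of_tendsto' hd.tendsto
    (E := s ×ˢ t) (by simpa using hfr)
  simp only [ProbabilityMeasure.coe_mk, Measure.map_id, Measure.prod_prod] at h1
  have h2 := (ENNReal.tendsto_toReal (ENNReal.mul_ne_top (measure_ne_top _ _)
    (measure_ne_top _ _))).comp h1
  rw [ENNReal.toReal_mul] at h2
  refine h2.congr fun n => ?_
  simp only [Function.comp_apply]
  rw [Measure.map_apply_of_aemeasurable (hd.forall_aemeasurable n) (hs.prod ht)]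
  rfl

lemma congr_small {Y' Z' : ℕ → Ω → ℝ} (h : MomentsTendstoGaussian P Y Z)
    (hY : MomentBounded P Y) (hZ : MomentBounded P Z)
    (hY' : MomentBounded P Y') (hZ' : MomentBounded P Z')
    (hYY' : MomentSmall P (fun n ω => Y' n ω - Y n ω))
    (hZZ' : MomentSmall P (fun n ω => Z' n ω - Z n ω)) : MomentsTendstoGaussian P Y' Z' := by
  intro p q
  simpa using (tendsto_integral_mul_pow_sub hY' hY hZ' hZ hYY' hZZ' p q).add (h p q)

end MomentsTendstoGaussian

/-! ### Cells -/

lemma measurableSet_cell (k : ℕ) (j : ℤ) : MeasurableSet (cell k j) := measurableSet_Ico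

lemma gaussianReal_frontier_cell (k : ℕ) (j : ℤ) :
    gaussianReal 0 1 (frontier (cell k j)) = 0 := by
  have := nullSingletonClass_gaussianReal (μ := 0) (v := 1) one_ne_zero
  rw [cell, frontier_Ico (by gcongr; linarith)]
  exact (Set.toFinite _).measure_zero _

section Sums

variable {P : Measure Ω} [IsProbabilityMeasure P] {X : ℕ → Ω → ℝ} {τ : ℕ → ℕ}
  {ε ε' : ℕ → Ω → ℝ}

/-- The square of `perturbedScale` is the (2, 0) moment, so the scale tends to 1. All the event
probabilities then have Gaussian limits, which cancel in both relations. -/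
theorem probCond_of_momentsTendstoGaussian
    (hY : ∀ n, HasMoments P (fun ω => firstBlock P X τ n ω + ε n ω))
    (hZ : ∀ n, HasMoments P (fun ω => lastBlock P X τ n ω + ε' n ω))
    (h : MomentsTendstoGaussian P (fun n ω => firstBlock P X τ n ω + ε n ω)
      (fun n ω => lastBlock P X τ n ω + ε' n ω)) :
    ProbCondS P X τ ε ε' ∧ ProbCondI P X τ ε ε' := by
  have hscale : Tendsto (fun n => (perturbedScale P X τ ε n)⁻¹) atTop (𝓝 1) := by
    have h1 := h 2 0
    simp only [pow_zero, mul_one, gaussianMoment_two, gaussianMoment_zero] at h1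
    have h2 := ((Real.continuous_sqrt.tendsto 1).comp h1).inv₀ (by simp)
    simpa [Function.comp_def, perturbedScale] using h2
  have h' := h.const_mul hscale
  have hY' := fun n => (hY n).const_mul (perturbedScale P X τ ε n)⁻¹
  have hZ' := fun n => (hZ n).const_mul (perturbedScale P X τ ε n)⁻¹
  have hA : ∀ k j, Tendsto (fun n => P.real (eventA P X τ ε k j n)) atTop
      (𝓝 ((gaussianReal 0 1).real (cell k j))) := fun k j => by
    simpa [eventA] using h'.tendsto_measureReal_inter hY' hZ' (measurableSet_cell k j)
      MeasurableSet.univ (gaussianReal_frontier_cell k j) (by simp)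
  have hB : ∀ k j, Tendsto (fun n => P.real (eventB P X τ ε ε' k j n)) atTop
      (𝓝 ((gaussianReal 0 1).real (cell k j))) := fun k j => by
    simpa [eventB] using h'.tendsto_measureReal_inter hY' hZ' MeasurableSet.univ
      (measurableSet_cell k j) (by simp) (gaussianReal_frontier_cell k j)
  refine ⟨fun k j => ?_, fun k j j' => ?_⟩
  · simpa using (hA k j).sub (hB k j)
  · have h1 := h'.tendsto_measureReal_inter hY' hZ' (measurableSet_cell k j)
      (measurableSet_cell k j')
      (gaussianReal_frontier_cell k j) (gaussianReal_frontier_cell k j')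
    have h2 := h1.sub ((hA k j).mul (hB k j'))
    rwa [sub_self] at h2

end Sums

end

section

/-! ### Block lengths -/

namespace IsGapSequence

variable {τ : ℕ → ℕ}

lemma bddAbove (n : ℕ) : BddAbove {m : ℕ | 1 ≤ m ∧ 2 * m + τ m ≤ n} :=
  ⟨n, fun m hm => by have := hm.2; omega⟩

lemma blockLength_mem (h : IsGapSequence τ) {n : ℕ} (hn : 2 ≤ n) :
    1 ≤ blockLength τ n ∧ 2 * blockLength τ n + τ (blockLength τ n) ≤ n := by
  rw [blockLength, if_neg (by omega)]
  exact Nat.sSup_mem (s := {m : ℕ | 1 ≤ m ∧ 2 * m + τ m ≤ n})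
    ⟨1, le_rfl, by rw [h.one]; omega⟩ (bddAbove n)

lemma one_le_blockLength (h : IsGapSequence τ) (n : ℕ) : 1 ≤ blockLength τ n := by
  rcases le_or_gt n 1 with hn | hn
  · simp [blockLength, hn]
  · exact (h.blockLength_mem hn).1

lemma tendsto_blockLength : Tendsto (blockLength τ) atTop atTop := by
  refine tendsto_atTop.2 fun m => ?_
  -- The witness is m + 1 because members of the set must be at least 1, also when m = 0.
  filter_upwards [eventually_ge_atTop (2 * (m + 1) + τ (m + 1))] with n hn
  rw [blockLength, if_neg (by omega)]
  exact (Nat.le_succ m).trans (le_csSup (bddAbove n) ⟨by omega, hn⟩)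

end IsGapSequence

/-! ### Normalized partial sums as a block recursion -/

section Sums

variable {Ω : Type*} [MeasurableSpace Ω] {P : Measure Ω} {X : ℕ → Ω → ℝ} {τ : ℕ → ℕ}
  {ε ε' : ℕ → Ω → ℝ}

/-- The normalized partial sum `(X₁ + ... + Xₙ) / σ(n)`. -/
def normalizedSum (P : Measure Ω) (X : ℕ → Ω → ℝ) (n : ℕ) (ω : Ω) : ℝ :=
  (∑ i ∈ Finset.Icc 1 n, X i ω) / stdDev P X n

lemma firstBlock_eq (n : ℕ) : firstBlock P X τ n = normalizedSum P X (blockLength τ n) := rfl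

lemma integral_sum_Icc_eq_zero (hX : ∀ n, 1 ≤ n → HasMoments P (X n))
    (hmean : ∀ n, 1 ≤ n → ∫ ω, X n ω ∂P = 0) (n : ℕ) :
    ∫ ω, ∑ i ∈ Finset.Icc 1 n, X i ω ∂P = 0 := by
  rw [integral_finsetSum _ fun i hi => (hX i (Finset.mem_Icc.1 hi).1).integrable]
  exact Finset.sum_eq_zero fun i hi => hmean i (Finset.mem_Icc.1 hi).1

lemma normalizedSum_eq_mul (hσ : ∀ n, 1 ≤ n → 0 < stdDev P X n) (hτ : IsGapSequence τ) {n : ℕ}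
    (hn : 2 ≤ n) (ω : Ω) :
    normalizedSum P X n ω = stdDev P X (blockLength τ n) / stdDev P X n *
      (firstBlock P X τ n ω + middleBlock P X τ n ω + lastBlock P X τ n ω) := by
  have hmem := hτ.blockLength_mem hn
  have h0 := (hσ _ hmem.1).ne'
  have h1 := (hσ n (by omega)).ne'
  -- The truncated subtraction in `gapLength` is exact because `2 u(n) ≤ n` when n ≥ 2.
  have hlen : blockLength τ n + gapLength τ n + blockLength τ n = n := by
    rw [gapLength]; omega
  have hsum : ∑ i ∈ Finset.Icc 1 n, X i ω =
      ∑ i ∈ Finset.Icc 1 (blockLength τ n), X i ω +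
      ∑ i ∈ Finset.Icc (blockLength τ n + 1) (blockLength τ n + gapLength τ n), X i ω +
      ∑ i ∈ Finset.Icc (blockLength τ n + gapLength τ n + 1) n, X i ω := by
    have e : ∀ a b, Finset.Icc (a + 1) b = Finset.Ioc a b := fun a b => by
      ext; simp
    have e1 : ∀ b, Finset.Icc 1 b = Finset.Ioc 0 b := fun b => e 0 b
    rw [e1, e1, e, e, Finset.sum_Ioc_consecutive _ (Nat.zero_le _) (Nat.le_add_right _ _),
      Finset.sum_Ioc_consecutive _ (Nat.zero_le _) (by omega)]
  rw [normalizedSum, firstBlock, middleBlock, lastBlock, hlen, hsum]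
  field_simp

/-- Even moments are nonnegative, so no cancellation is possible in the sum. -/
lemma MomentSmall.of_tendsto_add_left (hε : ∀ n, HasMoments P (ε n))
    (h : ∀ p : ℕ, 1 ≤ p →
      Tendsto (fun n : ℕ => (∫ ω, ε n ω ^ p ∂P) + ∫ ω, ε' n ω ^ p ∂P) atTop (𝓝 0)) :
    MomentSmall P ε :=
  ⟨hε, fun p hp => squeeze_zero (fun _ => integral_even_pow_nonneg _ p)
    (fun _ => le_add_of_nonneg_right (integral_even_pow_nonneg _ p)) (h (2 * p) (by omega))⟩

variable [IsProbabilityMeasure P]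

lemma hasMoments_sum_Icc (hX : ∀ n, 1 ≤ n → HasMoments P (X n)) {a : ℕ} (ha : 1 ≤ a) (b : ℕ) :
    HasMoments P (fun ω => ∑ i ∈ Finset.Icc a b, X i ω) :=
  HasMoments.sum fun i hi => hX i (ha.trans (Finset.mem_Icc.1 hi).1)

lemma integral_normalizedSum_sq (hX : ∀ n, 1 ≤ n → HasMoments P (X n))
    (hmean : ∀ n, 1 ≤ n → ∫ ω, X n ω ∂P = 0) {n : ℕ} (hσ : 0 < stdDev P X n) :
    ∫ ω, normalizedSum P X n ω ^ 2 ∂P = 1 := by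
  have h1 : stdDev P X n ^ 2 = ∫ ω, (∑ i ∈ Finset.Icc 1 n, X i ω) ^ 2 ∂P := by
    rw [stdDev, Real.sq_sqrt (variance_nonneg _ _), variance_of_integral_eq_zero
      (hasMoments_sum_Icc hX le_rfl n).1.aemeasurable (integral_sum_Icc_eq_zero hX hmean n)]
  simp_rw [normalizedSum, div_pow, integral_div, ← h1]
  exact div_self (pow_pos hσ 2).ne'

lemma hasMoments_normalizedSum (hX : ∀ n, 1 ≤ n → HasMoments P (X n)) (n : ℕ) :
    HasMoments P (normalizedSum P X n) :=
  (hasMoments_sum_Icc hX le_rfl n).div_const _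

lemma hasMoments_middleBlock (hX : ∀ n, 1 ≤ n → HasMoments P (X n)) (n : ℕ) :
    HasMoments P (middleBlock P X τ n) :=
  (hasMoments_sum_Icc hX (Nat.le_add_left _ _) _).div_const _

lemma hasMoments_lastBlock (hX : ∀ n, 1 ≤ n → HasMoments P (X n)) (n : ℕ) :
    HasMoments P (lastBlock P X τ n) :=
  (hasMoments_sum_Icc hX (Nat.le_add_left _ _) _).div_const _

/-- Subtracting `ε + ε'` from the middle block compensates the perturbations of the outer blocks, so
the decomposition stays exact. -/
theorem blockRecursion (hX : ∀ n, 1 ≤ n → HasMoments P (X n))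
    (hmean : ∀ n, 1 ≤ n → ∫ ω, X n ω ∂P = 0) (hσ : ∀ n, 1 ≤ n → 0 < stdDev P X n)
    (hτ : IsGapSequence τ) (hξ : MomentSmall P (middleBlock P X τ)) (hε : MomentSmall P ε)
    (hε' : MomentSmall P ε') (hS : MomentCondS P X τ ε ε') (hI : MomentCondI P X τ ε ε') :
    BlockRecursion P (normalizedSum P X) (fun n ω => firstBlock P X τ n ω + ε n ω)
      (fun n ω => lastBlock P X τ n ω + ε' n ω)
      (fun n ω => middleBlock P X τ n ω - (ε n ω + ε' n ω)) (blockLength τ)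
      (fun n => stdDev P X (blockLength τ n) / stdDev P X n) where
  hasMoments := hasMoments_normalizedSum hX
  hasMoments_right n := (hasMoments_lastBlock hX n).add (hε'.1 n)
  small_left := by simpa only [firstBlock_eq, add_sub_cancel_left] using hε
  small_middle := hξ.sub (hε.add hε')
  lt_self n hn := by have := hτ.blockLength_mem hn; omega
  one_le := hτ.one_le_blockLength
  tendsto_atTop := IsGapSequence.tendsto_blockLength
  nonneg n := div_nonneg (Real.sqrt_nonneg _) (Real.sqrt_nonneg _)
  eq_mul n hn ω := by
    rw [normalizedSum_eq_mul hσ hτ hn]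
    ring
  integral_eq_zero n := by
    simp only [normalizedSum, integral_div, integral_sum_Icc_eq_zero hX hmean, zero_div]
  integral_sq_eq_one n hn := integral_normalizedSum_sq hX hmean (hσ n hn)
  tendsto_sub := hS
  tendsto_factor := hI

/-- If the moments of the unperturbed blocks converge, then `H_S` and `H_I` hold even without any
perturbation. -/
theorem condsSI_of_momentsTendstoGaussian
    (hS : ∀ n, HasMoments P (firstBlock P X τ n)) (hS' : ∀ n, HasMoments P (lastBlock P X τ n))
    (h : MomentsTendstoGaussian P (firstBlock P X τ) (lastBlock P X τ)) : CondsSI P X τ := by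
  have h0 := probCond_of_momentsTendstoGaussian (P := P) (X := X) (τ := τ)
    (ε := fun _ _ => 0) (ε' := fun _ _ => 0) (by simpa using hS) (by simpa using hS')
    (by simpa using h)
  refine ⟨fun _ _ => 0, fun _ _ => 0, ?_, h0.1, h0.2⟩
  constructor <;> simp

end Sums

end

end BlockCLT

end

theorem mainTheorem6 {Ω : Type*} [MeasurableSpace Ω] (P : Measure Ω) [IsProbabilityMeasure P]
    (X : ℕ → Ω → ℝ) (τ : ℕ → ℕ) (ε ε' : ℕ → Ω → ℝ)
    (hX_meas : ∀ n : ℕ, 1 ≤ n → Measurable (X n))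
    (hX_mean : ∀ n : ℕ, 1 ≤ n → ∫ ω, X n ω ∂P = 0)
    (hX_moments : ∀ n p : ℕ, 1 ≤ n → Integrable (fun ω => |X n ω| ^ p) P)
    (hσ : ∀ n : ℕ, 1 ≤ n → 0 < BlockCLT.stdDev P X n)
    (hτ : BlockCLT.IsGapSequence τ)
    (h_middle : ∀ p : ℕ, 1 ≤ p →
      Tendsto (fun n : ℕ => ∫ ω, BlockCLT.middleBlock P X τ n ω ^ p ∂P) atTop (𝓝 0))
    (hε_meas : ∀ n : ℕ, Measurable (ε n)) (hε'_meas : ∀ n : ℕ, Measurable (ε' n))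
    (hε_moments : ∀ n p : ℕ, Integrable (fun ω => |ε n ω| ^ p) P)
    (hε'_moments : ∀ n p : ℕ, Integrable (fun ω => |ε' n ω| ^ p) P)
    (hε : ∀ p : ℕ, 1 ≤ p →
      Tendsto (fun n : ℕ => (∫ ω, ε n ω ^ p ∂P) + ∫ ω, ε' n ω ^ p ∂P) atTop (𝓝 0))
    (h_mS : BlockCLT.MomentCondS P X τ ε ε')
    (h_mI : BlockCLT.MomentCondI P X τ ε ε') :
    (∀ p q : ℕ, Tendsto (fun n : ℕ =>
        ∫ ω, (BlockCLT.firstBlock P X τ n ω + ε n ω) ^ p *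
          (BlockCLT.lastBlock P X τ n ω + ε' n ω) ^ q ∂P) atTop
        (𝓝 (BlockCLT.gaussianMoment p * BlockCLT.gaussianMoment q))) ∧
      TendstoInDistribution
        (fun (n : ℕ) (ω : Ω) =>
          (BlockCLT.firstBlock P X τ n ω + ε n ω, BlockCLT.lastBlock P X τ n ω + ε' n ω))
        atTop (id : ℝ × ℝ → ℝ × ℝ) (fun _ => P) ((gaussianReal 0 1).prod (gaussianReal 0 1)) ∧
      BlockCLT.ProbCondS P X τ ε ε' ∧ BlockCLT.ProbCondI P X τ ε ε' ∧
      BlockCLT.CondsSI P X τ := by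
  have hX : ∀ n, 1 ≤ n → BlockCLT.HasMoments P (X n) := fun n hn =>
    ⟨(hX_meas n hn).aestronglyMeasurable, fun p => hX_moments n p hn⟩
  have hε_small : BlockCLT.MomentSmall P ε := .of_tendsto_add_left
    (fun n => ⟨(hε_meas n).aestronglyMeasurable, hε_moments n⟩) hε
  have hε'_small : BlockCLT.MomentSmall P ε' := .of_tendsto_add_left
    (fun n => ⟨(hε'_meas n).aestronglyMeasurable, hε'_moments n⟩)
    (fun p hp => (hε p hp).congr fun _ => add_comm _ _)
  have hξ : BlockCLT.MomentSmall P (BlockCLT.middleBlock P X τ) :=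
    ⟨BlockCLT.hasMoments_middleBlock hX, fun p hp => h_middle (2 * p) (by omega)⟩
  have hrec := BlockCLT.blockRecursion hX hX_mean hσ hτ hξ hε_small hε'_small h_mS h_mI
  have hlim := hrec.momentsTendstoGaussian
  have hprob := BlockCLT.probCond_of_momentsTendstoGaussian hrec.hasMoments_left
    hrec.hasMoments_right hlim
  have hS : BlockCLT.MomentBounded P (BlockCLT.firstBlock P X τ) :=
    hrec.momentBounded.comp (BlockCLT.blockLength τ)
  have hS' : BlockCLT.MomentBounded P (BlockCLT.lastBlock P X τ) := by
    simpa using hrec.momentBounded_right.add hε'_small.neg.momentBounded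
  -- `CondsSI` asks for centred perturbations, and `ε`, `ε'` need not be centred; hence they are
  -- removed altogether.
  have hlim' : BlockCLT.MomentsTendstoGaussian P (BlockCLT.firstBlock P X τ)
      (BlockCLT.lastBlock P X τ) :=
    hlim.congr_small hrec.momentBounded_left hrec.momentBounded_right hS hS'
      (by simpa using hε_small.neg) (by simpa using hε'_small.neg)
  exact ⟨hlim, hlim.tendstoInDistribution hrec.hasMoments_left hrec.hasMoments_right,
    hprob.1, hprob.2, BlockCLT.condsSI_of_momentsTendstoGaussian hS.1 hS'.1 hlim'⟩
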